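/- Let $\nu,k,c>0$ and consider the one-dimensional damped Euler--Poisson system on $\mathbb R\times(0,\infty)$ $$\rho_t+(\rho u)_x=0,\qquad u_t+uu_x=-k\phi_x-\nu u,\qquad -\phi_{xx}=\rho-c,$$ with initial data $\rho(\cdot,0)=\rho_0>0$, $u(\cdot,0)=u_0$, where $\rho_0,u_0\in C^1(\mathbb R)$, the neutrality condition $\int_{-\infty}^{\infty}(\rho_0-c)\,dx=0$ holds (as an improper integral), and $u_0(x)\to0$ as $x\to\pm\infty$. A global $C^1$ solution is a pair $\rho,u\in C^1(\mathbb R\times[0,\infty))$ which attains the initial data and satisfies the system for $t>0$ with some $\phi(\cdot,t)\in C^2(\mathbb R)$ such that $\phi_x(x,t)\to0$ as $x\to\pm\infty$ for every $t>0$ (so that neutrality holds at every time). There is at most one global $C^1$ solution. Moreover, a global $C^1$ solution exists if and only if $u_0\in C^2(\mathbb R)$ and, for every $x\in\mathbb R$, $(\rho_0(x),u_0'(x))$ lies in the following region, which depends only on $\nu,k,c$. 1. (Strong damping, $\nu>2\sqrt{kc}$.) The region is $\{(\rho,d):\rho>0,\ d>-\rho\,Q_a(1/\rho)\}$, where $Q_a:[0,\infty)\to[0,\infty)$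 is the unique continuous function with $$Q_a(0)=0,\qquad Q_a(s)\neq0\ \text{ and }\ \frac{dQ_a}{ds}=\nu+\frac{k}{Q_a}(1-cs)\quad\text{for } s>0 .$$ 2. (Borderline damping, $\nu=2\sqrt{kc}$.) The region is $\{(\rho,d):\rho>0,\ d>-\rho\,Q_b(1/\rho)\}$, where $Q_b:[0,\infty)\to[0,\infty)$ is the unique continuous function with $$Q_b(0)=0,\qquad Q_b(s)\neq0\ \text{ and }\ \frac{dQ_b}{ds}=2\sqrt{kc}+\frac{k}{Q_b}(1-cs)\quad\text{for } s>0 .$$ 3. (Weak damping, $\nu<2\sqrt{kc}$.) The region is $$\{(\rho,d):\rho>1/s^*,\ -\rho\,Q_1(1/\rho)<d<-\rho\,Q_2(s^*-1/\rho)\},$$ where $s^*>0$ and the continuous functions $Q_1:[0,s^*]\to[0,\infty)$, $Q_2:[0,s^*]\to(-\infty,0]$ are uniquely determined by the following requirements: $Q_1(0)=Q_1(s^*)=0$, $Q_2(0)=0$, and for $0<s<s^*$ both functions are nonzero and satisfy $$\frac{dQ_1}{ds}=\nu+\frac{k}{Q_1}(1-cs),\qquad \frac{dQ_2}{ds}=-\nu+\frac{k}{Q_2}\bigl(c(s^*-s)-1\bigr).$$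 The existence and uniqueness of $Q_a$, of $Q_b$, and of $(s^*,Q_1,Q_2)$ in the respective cases are part of the claim. -/

import Mathlib

open Set Filter Topology

namespace EulerPoisson

/-- Neutrality `∫ (ρ₀ - c) dx = 0` over the whole line, the integral being understood as an
improper one (so that it covers the case of an absolutely integrable `ρ₀ - c`). -/
def IsNeutral (c : ℝ) (ρ₀ : ℝ → ℝ) : Prop :=
  Tendsto (fun p : ℝ × ℝ => ∫ x in p.1..p.2, (ρ₀ x - c)) (atBot ×ˢ atTop) (𝓝 0)

/-- Admissible initial data: `C¹`, positive density, neutral, and at rest in the far field. -/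
structure IsInitialData (c : ℝ) (ρ₀ u₀ : ℝ → ℝ) : Prop where
  density_contDiff : ContDiff ℝ 1 ρ₀
  velocity_contDiff : ContDiff ℝ 1 u₀
  density_pos : ∀ x, 0 < ρ₀ x
  neutral : IsNeutral c ρ₀
  velocity_atBot : Tendsto u₀ atBot (𝓝 0)
  velocity_atTop : Tendsto u₀ atTop (𝓝 0)

/-- `(ρ, u)`, as functions of `x` and `t`, is a global `C¹` solution of the damped Euler-Poisson
system
`ρ_t + (ρ u)_x = 0`,  `u_t + u u_x = - k φ_x - ν u`,  `- φ_xx = ρ - c`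
with initial data `(ρ₀, u₀)`. Only the values for `t ≥ 0` matter. The field `φ_x` vanishes as
`x → ±∞`; by the Poisson equation this includes neutrality of `ρ(·, t)`. -/
structure IsGlobalSolution (ν k c : ℝ) (ρ₀ u₀ : ℝ → ℝ) (ρ u : ℝ → ℝ → ℝ) : Prop where
  density_contDiffOn : ContDiffOn ℝ 1 (fun p : ℝ × ℝ => ρ p.1 p.2) (univ ×ˢ Ici 0)
  velocity_contDiffOn : ContDiffOn ℝ 1 (fun p : ℝ × ℝ => u p.1 p.2) (univ ×ˢ Ici 0)
  density_initial : ∀ x, ρ x 0 = ρ₀ x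
  velocity_initial : ∀ x, u x 0 = u₀ x
  mass : ∀ x t, 0 < t →
    deriv (fun τ => ρ x τ) t + deriv (fun y => ρ y t * u y t) x = 0
  momentum_poisson : ∃ φ : ℝ → ℝ → ℝ, ∀ t, 0 < t →
    ContDiff ℝ 2 (fun y => φ y t) ∧
    Tendsto (deriv fun y => φ y t) atBot (𝓝 0) ∧
    Tendsto (deriv fun y => φ y t) atTop (𝓝 0) ∧
    ∀ x,
      deriv (fun τ => u x τ) t + u x t * deriv (fun y => u y t) x
          = - k * deriv (fun y => φ y t) x - ν * u x t ∧
      - deriv (deriv fun y => φ y t) x = ρ x t - c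

/-- A continuous `Q : [0, ∞) → [0, ∞)` with `Q 0 = 0` and `dQ/ds = ν + (k / Q) (1 - c s)` for
`s > 0` (values at negative arguments are irrelevant). -/
structure IsThresholdCurve (ν k c : ℝ) (Q : ℝ → ℝ) : Prop where
  continuousOn : ContinuousOn Q (Ici 0)
  nonneg : ∀ s ∈ Ici (0 : ℝ), 0 ≤ Q s
  zero : Q 0 = 0
  ode : ∀ s ∈ Ioi (0 : ℝ), Q s ≠ 0 ∧ HasDerivAt Q (ν + k / Q s * (1 - c * s)) s

/-- The backward trajectory from the origin in the underdamped case. It leaves the origin along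
`r = Q₁ s ≥ 0`, meets the axis `r = 0` again at `s = S > 0`, and then returns to `s = 0` along
`r = Q₂ (S - s) ≤ 0`. -/
structure IsThresholdLoop (ν k c S : ℝ) (Q₁ Q₂ : ℝ → ℝ) : Prop where
  pos : 0 < S
  continuousOn_one : ContinuousOn Q₁ (Icc 0 S)
  nonneg_one : ∀ s ∈ Icc 0 S, 0 ≤ Q₁ s
  zero_one : Q₁ 0 = 0
  end_one : Q₁ S = 0
  ode_one : ∀ s ∈ Ioo 0 S, Q₁ s ≠ 0 ∧ HasDerivAt Q₁ (ν + k / Q₁ s * (1 - c * s)) s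
  continuousOn_two : ContinuousOn Q₂ (Icc 0 S)
  nonpos_two : ∀ s ∈ Icc 0 S, Q₂ s ≤ 0
  zero_two : Q₂ 0 = 0
  ode_two : ∀ s ∈ Ioo 0 S,
    Q₂ s ≠ 0 ∧ HasDerivAt Q₂ (-ν + k / Q₂ s * (c * (S - s) - 1)) s

/-- The region `{(ρ, d) : d > -ρ Q(1/ρ), ρ > 0}`. -/
def curveRegion (Q : ℝ → ℝ) : Set (ℝ × ℝ) :=
  {p | 0 < p.1 ∧ -p.1 * Q (1 / p.1) < p.2}

/-- The region `{(ρ, d) : -ρ Q₁(1/ρ) < d < -ρ Q₂(S - 1/ρ), ρ > 1/S}`. -/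
def loopRegion (S : ℝ) (Q₁ Q₂ : ℝ → ℝ) : Set (ℝ × ℝ) :=
  {p | 1 / S < p.1 ∧ -p.1 * Q₁ (1 / p.1) < p.2 ∧ p.2 < -p.1 * Q₂ (S - 1 / p.1)}

end EulerPoisson

/-! In Lagrangian coordinates the system is a family of damped harmonic oscillators. With `E = φ_x`,
the mass equation shows that along a characteristic `X` from `x` one has `E(X(t),t) = E(x,0) + c
(X(t) - x) + γ(t)`, where the drift `γ` is the same for all characteristics
(`IsFlowSolution.field_along`). Letting `x → +∞`, where the initial velocity and the field die out,
forces `γ = 0` and normalizes the initial field to vanish at infinity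
(`far_field_add_drift_eq_zero`, `far_field_eq_zero`). Hence `X'' + ν X' + k c (X - x) = -k E₀(x)`,
and flow and velocity are explicit in the impulse response `A` of the oscillator.

The Jacobian `Γ = ∂X/∂x` satisfies `ρ(X,t) Γ = ρ₀(x)`. So `Γ` cannot vanish for a global solution,
and since the flow map is onto, the solution is determined by the data, which gives uniqueness.
Solving this identity for `u₀'` at a time with `A t ≠ 0` shows `u₀ ∈ C²`. Conversely, if `u₀ ∈ C²`
and `Γ > 0` for all `t ≥ 0`, inverting the flow produces a solution. Thus global existence means
that `u₀ ∈ C²` and, for every `x`, the specific volume `Γ/ρ₀` stays positive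
(`exists_isGlobalSolution_iff`).

The specific volume solves `s'' + ν s' + k (c s - 1) = 0` with initial point `(s, r) = (1/ρ₀,
u₀'/ρ₀)`. The critical trajectory is the one touching `s = 0` with `r = 0`; followed backwards in
time it bounds the region. Two trajectories through the same `s` differ by a multiple of `A`
(`specificVolume_backwardVolume`), so the sign of `A` decides everything. For strong or borderline
damping `A > 0` for positive times and the backward trajectory is a graph over `[0, ∞)`. For weak
damping `A` changes sign every half-period `P`: the first arc controls `0 < t < P`, the condition `s
< s*` controls `t = P`, the returning arc controls `P < t < 2P`, and contraction towards `1/c` over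
a full period handles later times. -/

namespace EulerPoisson

/-! ### The damped oscillator: energy estimate and impulse response -/

/-- `A` is the impulse response of the damped oscillator `A'' + ν A' + κ A = 0`, and `A'` is its
derivative. -/
structure IsImpulseResponse (ν κ : ℝ) (A A' : ℝ → ℝ) : Prop where
  zero : A 0 = 0
  one : A' 0 = 1
  hasDerivAt : ∀ t, HasDerivAt A (A' t) t
  hasDerivAt' : ∀ t, HasDerivAt A' (-ν * A' t - κ * A t) t

/-- The energy changes at rate `-2 ν w² + 2 w f`, which completing the square bounds by `f² / (2
ν)`. Differential equations are required only on the open interval, since the Euler-Poisson system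
is only imposed for `t > 0`. The bound later confines characteristics uniformly in their starting
point. -/
theorem oscillator_energy_le {ν κ T M : ℝ} (hν : 0 < ν) {z w f : ℝ → ℝ}
    (hz : ContinuousOn z (Icc 0 T)) (hw : ContinuousOn w (Icc 0 T))
    (hz' : ∀ t ∈ Ioo 0 T, HasDerivAt z (w t) t)
    (hw' : ∀ t ∈ Ioo 0 T, HasDerivAt w (-ν * w t - κ * z t + f t) t)
    (hf : ∀ t ∈ Ioo 0 T, |f t| ≤ M) {t : ℝ} (ht : t ∈ Icc 0 T) :
    w t ^ 2 + κ * z t ^ 2 ≤ w 0 ^ 2 + κ * z 0 ^ 2 + t * (M ^ 2 / (2 * ν)) := by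
  have hanti : AntitoneOn (fun t => w t ^ 2 + κ * z t ^ 2 - t * (M ^ 2 / (2 * ν))) (Icc 0 T) := by
    refine antitoneOn_of_hasDerivWithinAt_nonpos (convex_Icc 0 T) (by fun_prop)
      (f' := fun t => 2 * w t * (-ν * w t - κ * z t + f t) + κ * (2 * z t * w t)
        - M ^ 2 / (2 * ν)) ?_ ?_
    · intro t ht
      rw [interior_Icc] at ht
      have h := (((hw' t ht).pow 2).add (((hz' t ht).pow 2).const_mul κ)).sub
        ((hasDerivAt_id t).mul_const (M ^ 2 / (2 * ν)))
      refine (h.congr_deriv ?_).hasDerivWithinAt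
      simp
    · intro t ht
      rw [interior_Icc] at ht
      have h1 : f t ^ 2 ≤ M ^ 2 := sq_le_sq' (abs_le.1 (hf t ht)).1 (abs_le.1 (hf t ht)).2
      have h2 : M ^ 2 / (2 * ν) = f t ^ 2 / (2 * ν) + (M ^ 2 - f t ^ 2) / (2 * ν) := by ring
      have h3 : 0 ≤ (M ^ 2 - f t ^ 2) / (2 * ν) := by
        apply div_nonneg <;> linarith
      have h4 : 2 * w t * (-ν * w t - κ * z t + f t) + κ * (2 * z t * w t) - f t ^ 2 / (2 * ν)
          = -((2 * ν * w t - f t) ^ 2 / (2 * ν)) := by field_simp; ring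
      have h5 : 0 ≤ (2 * ν * w t - f t) ^ 2 / (2 * ν) := by positivity
      linarith
  have h := hanti ⟨le_rfl, ht.1.trans ht.2⟩ ht ht.1
  simp only [zero_mul, sub_zero] at h
  linarith

/-- Without forcing the energy cannot grow from zero. This serves as the uniqueness theorem behind
all explicit formulas in terms of `A`. -/
theorem oscillator_eq_zero {ν κ T : ℝ} (hν : 0 < ν) (hκ : 0 < κ) {z w : ℝ → ℝ}
    (hz : ContinuousOn z (Icc 0 T)) (hw : ContinuousOn w (Icc 0 T))
    (hz' : ∀ t ∈ Ioo 0 T, HasDerivAt z (w t) t)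
    (hw' : ∀ t ∈ Ioo 0 T, HasDerivAt w (-ν * w t - κ * z t) t)
    (hz0 : z 0 = 0) (hw0 : w 0 = 0) {t : ℝ} (ht : t ∈ Icc 0 T) : z t = 0 ∧ w t = 0 := by
  have h := oscillator_energy_le (κ := κ) (M := 0) (f := fun _ => 0) hν hz hw hz'
    (by simpa using hw') (by simp) ht
  norm_num [hz0, hw0] at h
  have h1 : 0 ≤ κ * z t ^ 2 := by positivity
  have h2 : w t ^ 2 = 0 := by nlinarith [sq_nonneg (w t)]
  have h3 : κ * z t ^ 2 = 0 := by nlinarith [sq_nonneg (w t)]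
  refine ⟨?_, by simpa using h2⟩
  simpa [hκ.ne'] using h3

namespace IsImpulseResponse

variable {ν κ : ℝ} {A A' : ℝ → ℝ}

theorem continuous (h : IsImpulseResponse ν κ A A') : Continuous A :=
  continuous_iff_continuousAt.2 fun t => (h.hasDerivAt t).continuousAt

theorem continuous' (h : IsImpulseResponse ν κ A A') : Continuous A' :=
  continuous_iff_continuousAt.2 fun t => (h.hasDerivAt' t).continuousAt

theorem deriv_eq (h : IsImpulseResponse ν κ A A') : deriv A = A' :=
  funext fun t => (h.hasDerivAt t).deriv

theorem deriv_eq' (h : IsImpulseResponse ν κ A A') :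
    deriv A' = fun t => -ν * A' t - κ * A t :=
  funext fun t => (h.hasDerivAt' t).deriv

theorem contDiff_one' (h : IsImpulseResponse ν κ A A') : ContDiff ℝ 1 A' := by
  rw [contDiff_one_iff_deriv, h.deriv_eq']
  have := h.continuous
  have := h.continuous'
  exact ⟨fun t => (h.hasDerivAt' t).differentiableAt, by fun_prop⟩

theorem contDiff_one (h : IsImpulseResponse ν κ A A') : ContDiff ℝ 1 A := by
  rw [contDiff_one_iff_deriv, h.deriv_eq]
  exact ⟨fun t => (h.hasDerivAt t).differentiableAt, h.continuous'⟩

/-- The step response `A' + ν A` has derivative `-κ A`. -/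
theorem hasDerivAt_step (h : IsImpulseResponse ν κ A A') (t : ℝ) :
    HasDerivAt (fun t => A' t + ν * A t) (-κ * A t) t :=
  ((h.hasDerivAt' t).add ((h.hasDerivAt t).const_mul ν)).congr_deriv (by ring)

/-- Solutions of the oscillator with constant forcing, expressed through the impulse response. -/
theorem eq_of_forced {k c T e : ℝ} (h : IsImpulseResponse ν (k * c) A A') (hν : 0 < ν)
    (hk : 0 < k) (hc : 0 < c) {Y U : ℝ → ℝ}
    (hY : ContinuousOn Y (Icc 0 T)) (hU : ContinuousOn U (Icc 0 T))
    (hY' : ∀ t ∈ Ioo 0 T, HasDerivAt Y (U t) t)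
    (hU' : ∀ t ∈ Ioo 0 T, HasDerivAt U (-k * (e + c * Y t) - ν * U t) t)
    (hY0 : Y 0 = 0) {t : ℝ} (ht : t ∈ Icc 0 T) :
    Y t = A t * U 0 + (A' t + ν * A t - 1) / c * e ∧ U t = A' t * U 0 - k * A t * e := by
  have hA := h.continuous
  have hA' := h.continuous'
  have := oscillator_eq_zero (z := fun t => Y t - (A t * U 0 + (A' t + ν * A t - 1) / c * e))
    (w := fun t => U t - (A' t * U 0 - k * A t * e)) hν (mul_pos hk hc)
    (hY.sub (by fun_prop)) (hU.sub (by fun_prop))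
    (fun t ht => ((hY' t ht).sub (((h.hasDerivAt t).mul_const (U 0)).add
      ((((h.hasDerivAt_step t).sub_const 1).div_const c).mul_const e))).congr_deriv
        (by field_simp; ring))
    (fun t ht => ((hU' t ht).sub (((h.hasDerivAt' t).mul_const (U 0)).sub
      (((h.hasDerivAt t).const_mul k).mul_const e))).congr_deriv
        (by field_simp; ring))
    (by simp [hY0, h.zero, h.one]) (by simp [h.zero, h.one]) ht
  exact ⟨by linarith [this.1], by linarith [this.2]⟩

theorem exists_ne_zero (h : IsImpulseResponse ν κ A A') : ∃ t, 0 < t ∧ A t ≠ 0 := by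
  by_contra! hA
  have h1 : HasDerivWithinAt A (A' 0) (Ioi 0) 0 := (h.hasDerivAt 0).hasDerivWithinAt
  have h2 : HasDerivWithinAt A 0 (Ioi 0) 0 :=
    (hasDerivWithinAt_const 0 (Ioi 0) (0 : ℝ)).congr (fun t ht => hA t ht) h.zero
  have := (uniqueDiffWithinAt_Ioi (0 : ℝ)).eq_deriv _ h1 h2
  rw [h.one] at this
  exact one_ne_zero this

end IsImpulseResponse

/-! ### Explicit impulse responses in the three damping regimes -/

/-- Impulse response in the overdamped case. -/
theorem isImpulseResponse_sinh {ν κ μ : ℝ} (hμ : μ ≠ 0) (h : ν ^ 2 / 4 - κ = μ ^ 2) :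
    IsImpulseResponse ν κ (fun t => Real.exp (-(ν / 2) * t) * (Real.sinh (μ * t) / μ))
      (fun t => Real.exp (-(ν / 2) * t) * (Real.cosh (μ * t) - ν / 2 * (Real.sinh (μ * t) / μ))) := by
  have hid : ∀ (a t : ℝ), HasDerivAt (fun t => a * t) a t := fun a t => by
    simpa using (hasDerivAt_id t).const_mul a
  have he : ∀ t, HasDerivAt (fun t => Real.exp (-(ν / 2) * t)) _ t := fun t => (hid (-(ν / 2)) t).exp
  have hs : ∀ t, HasDerivAt (fun t => Real.sinh (μ * t) / μ) _ t := fun t =>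
    ((hid μ t).sinh).div_const μ
  refine ⟨by simp, by simp, fun t => ((he t).mul (hs t)).congr_deriv (by field_simp; ring),
    fun t => ((he t).mul (((hid μ t).cosh).sub ((hs t).const_mul (ν / 2)))).congr_deriv ?_⟩
  have : κ = ν ^ 2 / 4 - μ ^ 2 := by linarith
  subst this
  simp only [Pi.sub_apply]
  field_simp
  ring

/-- Impulse response in the critically damped case. -/
theorem isImpulseResponse_critical {ν κ : ℝ} (h : ν ^ 2 / 4 = κ) :
    IsImpulseResponse ν κ (fun t => Real.exp (-(ν / 2) * t) * t)
      (fun t => Real.exp (-(ν / 2) * t) * (1 - ν / 2 * t)) := by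
  have hid : ∀ (a t : ℝ), HasDerivAt (fun t => a * t) a t := fun a t => by
    simpa using (hasDerivAt_id t).const_mul a
  have he : ∀ t, HasDerivAt (fun t => Real.exp (-(ν / 2) * t)) _ t := fun t => (hid (-(ν / 2)) t).exp
  refine ⟨by simp, by simp, fun t => ((he t).mul (hasDerivAt_id t)).congr_deriv (by simp; ring),
    fun t => ((he t).mul ((hid (ν / 2) t).const_sub 1)).congr_deriv ?_⟩
  subst h
  ring

/-- Impulse response in the underdamped case. -/
theorem isImpulseResponse_sin {ν κ ω : ℝ} (hω : ω ≠ 0) (h : κ - ν ^ 2 / 4 = ω ^ 2) :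
    IsImpulseResponse ν κ (fun t => Real.exp (-(ν / 2) * t) * (Real.sin (ω * t) / ω))
      (fun t => Real.exp (-(ν / 2) * t) * (Real.cos (ω * t) - ν / 2 * (Real.sin (ω * t) / ω))) := by
  have hid : ∀ (a t : ℝ), HasDerivAt (fun t => a * t) a t := fun a t => by
    simpa using (hasDerivAt_id t).const_mul a
  have he : ∀ t, HasDerivAt (fun t => Real.exp (-(ν / 2) * t)) _ t := fun t => (hid (-(ν / 2)) t).exp
  have hs : ∀ t, HasDerivAt (fun t => Real.sin (ω * t) / ω) _ t := fun t =>
    ((hid ω t).sin).div_const ω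
  refine ⟨by simp, by simp, fun t => ((he t).mul (hs t)).congr_deriv (by field_simp; ring),
    fun t => ((he t).mul (((hid ω t).cos).sub ((hs t).const_mul (ν / 2)))).congr_deriv ?_⟩
  have : κ = ν ^ 2 / 4 + ω ^ 2 := by linarith
  subst this
  simp only [Pi.sub_apply]
  field_simp
  ring

/-! ### Phase-plane curves as graphs, and the singular threshold equation -/

/-- Reparametrization of a planar curve `(σ, q)` by its first coordinate, when that increases. -/
theorem exists_graph_of_curve {I : Set ℝ} (hI : Convex ℝ I) {σ v q p : ℝ → ℝ}
    (hσ : ∀ t, HasDerivAt σ (v t) t) (hq : ∀ t, HasDerivAt q (p t) t)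
    (hv : ∀ t ∈ interior I, 0 < v t) :
    StrictMonoOn σ I ∧ ∃ Q : ℝ → ℝ, ContinuousOn Q (σ '' I) ∧ (∀ t ∈ I, Q (σ t) = q t) ∧
      ∀ t ∈ interior I, HasDerivAt Q (p t / v t) (σ t) := by
  have hσc : Continuous σ := continuous_iff_continuousAt.2 fun t => (hσ t).continuousAt
  have hqc : Continuous q := continuous_iff_continuousAt.2 fun t => (hq t).continuousAt
  have hmono : StrictMonoOn σ I := strictMonoOn_of_deriv_pos hI hσc.continuousOn
    fun t ht => by rw [(hσ t).deriv]; exact hv t ht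
  have hIo : I.OrdConnected := hI.ordConnected
  have hJo : (σ '' I).OrdConnected :=
    (hI.isPreconnected.image σ hσc.continuousOn).ordConnected
  set g := Function.invFunOn σ I
  have hgl : ∀ t ∈ I, g (σ t) = t := fun t ht => hmono.injOn.leftInvOn_invFunOn ht
  -- Continuity of the inverse comes from order alone, because `v` may vanish at the endpoints of
  -- `I`; the threshold curves have such endpoints, where they meet the axis `r = 0`.
  have hgc : ContinuousOn g (σ '' I) := by
    rw [continuousOn_iff_continuous_domRestrict]
    have h1 : Continuous (fun y => (((hmono.orderIso σ I).symm y : I) : ℝ)) :=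
      continuous_subtype_val.comp (OrderIso.continuous _)
    convert h1 using 2 with y
    obtain ⟨t, rfl⟩ := (hmono.orderIso σ I).surjective y
    simp only [OrderIso.symm_apply_apply]
    exact hgl t t.2
  refine ⟨hmono, fun y => q (g y), hqc.comp_continuousOn hgc, fun t ht => by
    simp only [hgl t ht], fun t ht => ?_⟩
  have hnhds : σ '' I ∈ 𝓝 (σ t) := by
    obtain ⟨ε, hε, hball⟩ := Metric.isOpen_iff.1 isOpen_interior t ht
    have ha : t - ε / 2 ∈ I := interior_subset (hball (by
      rw [Metric.mem_ball, Real.dist_eq, abs_lt]; constructor <;> linarith))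
    have hb : t + ε / 2 ∈ I := interior_subset (hball (by
      rw [Metric.mem_ball, Real.dist_eq, abs_lt]; constructor <;> linarith))
    exact mem_of_superset (Icc_mem_nhds (hmono ha (interior_subset ht) (by linarith))
      (hmono (interior_subset ht) hb (by linarith)))
      (hJo.out (mem_image_of_mem σ ha) (mem_image_of_mem σ hb))
  have hg' : HasDerivAt g (v t)⁻¹ (σ t) := by
    refine HasDerivAt.of_local_left_inverse (f := σ) (hgc.continuousAt hnhds) ?_ (hv t ht).ne' ?_
    · rw [hgl t (interior_subset ht)]; exact hσ t
    · filter_upwards [hnhds] with y hy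
      obtain ⟨t', ht', rfl⟩ := hy
      rw [hgl t' ht']
  have h2 : HasDerivAt q (p t) (g (σ t)) := by
    rw [hgl t (interior_subset ht)]; exact hq t
  exact (h2.comp (σ t) hg').congr_deriv (by rw [div_eq_mul_inv])

/-- The right-hand side is singular at `0`, where the threshold curves vanish, so Picard-Lindelöf
does not apply there. But `D = P - Q` satisfies `D' = -(k g / (P Q)) D`. Near `0` one has `g > 0`,
so `D²` decreases from the value `0`; past that the coefficient is bounded on compact intervals and
Grönwall's inequality continues `D = 0`. -/
theorem eqOn_of_threshold_ode {k m L : ℝ} (hk : 0 < k) (hL : 0 < L) {g P Q : ℝ → ℝ}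
    (hg : Continuous g) (hg0 : 0 < g 0)
    (hP : ContinuousOn P (Icc 0 L)) (hQ : ContinuousOn Q (Icc 0 L)) (h0 : P 0 = Q 0)
    (hPQ : ∀ s ∈ Ioo 0 L, 0 < P s * Q s)
    (hP' : ∀ s ∈ Ioo 0 L, HasDerivAt P (m + k / P s * g s) s)
    (hQ' : ∀ s ∈ Ioo 0 L, HasDerivAt Q (m + k / Q s * g s) s) :
    EqOn P Q (Icc 0 L) := by
  have hD : ∀ s ∈ Ioo 0 L, HasDerivAt (fun s => P s - Q s)
      (-(k * g s / (P s * Q s)) * (P s - Q s)) s := fun s hs => by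
    have h1 : P s ≠ 0 := left_ne_zero_of_mul (hPQ s hs).ne'
    have h2 : Q s ≠ 0 := right_ne_zero_of_mul (hPQ s hs).ne'
    refine ((hP' s hs).sub (hQ' s hs)).congr_deriv ?_
    field_simp
    ring
  obtain ⟨ε, hε, hball⟩ := Metric.isOpen_iff.1 (isOpen_lt continuous_const hg) 0 hg0
  obtain ⟨δ, hδ0, hδ⟩ : ∃ δ, 0 < δ ∧ δ < min ε L := exists_between (lt_min hε hL)
  have hδε : δ < ε := hδ.trans_le (min_le_left _ _)
  have hδL : δ < L := hδ.trans_le (min_le_right _ _)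
  have hanti : AntitoneOn (fun s => (P s - Q s) ^ 2) (Icc 0 δ) := by
    have hsub : Icc 0 δ ⊆ Icc 0 L := Icc_subset_Icc_right hδL.le
    refine antitoneOn_of_hasDerivWithinAt_nonpos (convex_Icc 0 δ)
      (f' := fun s => 2 * (P s - Q s) * (-(k * g s / (P s * Q s)) * (P s - Q s)))
      (((hP.mono hsub).sub (hQ.mono hsub)).pow 2) ?_ ?_
    · intro s hs
      rw [interior_Icc] at hs
      exact (((hD s ⟨hs.1, hs.2.trans hδL⟩).pow 2).congr_deriv (by simp)).hasDerivWithinAt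
    · intro s hs
      rw [interior_Icc] at hs
      have h1 : 0 < g s := hball (by
        rw [Metric.mem_ball, Real.dist_eq, sub_zero, abs_of_pos hs.1]; linarith [hs.2])
      have h2 := hPQ s ⟨hs.1, hs.2.trans hδL⟩
      have h3 : 0 ≤ k * g s / (P s * Q s) * (P s - Q s) ^ 2 := by positivity
      linarith
  have hzero : ∀ s ∈ Icc 0 δ, P s - Q s = 0 := fun s hs => by
    have h1 := hanti ⟨le_rfl, hδ0.le⟩ hs hs.1
    simp only [h0, sub_self] at h1
    nlinarith [sq_nonneg (P s - Q s)]
  have hIco : EqOn P Q (Ico 0 L) := by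
    intro x hx
    rcases le_or_gt x δ with hxδ | hxδ
    · exact sub_eq_zero.1 (hzero x ⟨hx.1, hxδ⟩)
    have hsub : Icc δ x ⊆ Ioo 0 L := fun y hy => ⟨hδ0.trans_le hy.1, hy.2.trans_lt hx.2⟩
    have hsub' : Icc δ x ⊆ Icc 0 L := hsub.trans Ioo_subset_Icc_self
    have hcont : ContinuousOn (fun s => -(k * g s / (P s * Q s))) (Icc δ x) :=
      ((continuousOn_const.mul hg.continuousOn).div ((hP.mono hsub').mul (hQ.mono hsub'))
        fun y hy => (hPQ y (hsub hy)).ne').neg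
    obtain ⟨K, hK⟩ := isCompact_Icc.exists_bound_of_continuousOn hcont
    refine sub_eq_zero.1 (eq_zero_of_abs_deriv_le_mul_abs_self_of_eq_zero_right
      (f := fun s => P s - Q s) ((hP.mono hsub').sub (hQ.mono hsub'))
      (fun y hy => (hD y (hsub (Ico_subset_Icc_self hy))).hasDerivWithinAt)
      (hzero δ ⟨hδ0.le, le_rfl⟩) (K := K) (fun y hy => ?_) x ⟨hxδ.le, le_rfl⟩)
    rw [norm_mul]
    exact mul_le_mul_of_nonneg_right (hK y (Ico_subset_Icc_self hy)) (norm_nonneg _)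
  refine hIco.of_subset_closure hP hQ Ico_subset_Icc_self ?_
  rw [closure_Ico hL.ne]

/-! ### Trajectories of the specific volume in the phase plane -/

/-- The specific volume `1/ρ` along a characteristic, with initial value `s` and initial
derivative `r`, in terms of the impulse response. -/
noncomputable def specificVolume (ν c : ℝ) (A A' : ℝ → ℝ) (s r t : ℝ) : ℝ :=
  1 / c + (A' t + ν * A t) * (s - 1 / c) + A t * r

/-- The trajectory ending at the origin of the phase plane, backwards in time. -/
noncomputable def backwardVolume (ν c : ℝ) (A A' : ℝ → ℝ) (τ : ℝ) : ℝ :=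
  specificVolume ν c A A' 0 0 (-τ)

namespace IsImpulseResponse

variable {ν k c : ℝ} {A A' : ℝ → ℝ}

theorem specificVolume_zero (h : IsImpulseResponse ν (k * c) A A') (s r : ℝ) :
    specificVolume ν c A A' s r 0 = s := by
  simp [specificVolume, h.zero, h.one]

theorem hasDerivAt_specificVolume (h : IsImpulseResponse ν (k * c) A A') (s r t : ℝ) :
    HasDerivAt (specificVolume ν c A A' s r)
      (-(k * c) * A t * (s - 1 / c) + A' t * r) t :=
  (((h.hasDerivAt_step t).mul_const (s - 1 / c)).const_add (1 / c)).add
    ((h.hasDerivAt t).mul_const r)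

theorem hasDerivAt_backwardVolume (h : IsImpulseResponse ν (k * c) A A') (hc : c ≠ 0) (τ : ℝ) :
    HasDerivAt (backwardVolume ν c A A') (-k * A (-τ)) τ := by
  refine ((h.hasDerivAt_specificVolume 0 0 (-τ)).comp τ (hasDerivAt_neg τ)).congr_deriv ?_
  field_simp
  ring

theorem hasDerivAt_backwardRate (h : IsImpulseResponse ν (k * c) A A') (τ : ℝ) :
    HasDerivAt (fun τ => -k * A (-τ)) (k * A' (-τ)) τ :=
  (((h.hasDerivAt (-τ)).comp τ (hasDerivAt_neg τ)).const_mul (-k)).congr_deriv (by ring)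

theorem continuous_backwardVolume (h : IsImpulseResponse ν (k * c) A A') (hc : c ≠ 0) :
    Continuous (backwardVolume ν c A A') :=
  continuous_iff_continuousAt.2 fun t => (h.hasDerivAt_backwardVolume hc t).continuousAt

theorem backwardVolume_zero (h : IsImpulseResponse ν (k * c) A A') :
    backwardVolume ν c A A' 0 = 0 := by
  simp [backwardVolume, h.specificVolume_zero]

/-- Slope of the backward trajectory. -/
theorem backward_slope (hc : c ≠ 0) (hk : k ≠ 0) {τ : ℝ} (hA : A (-τ) ≠ 0) :
    k * A' (-τ) / (-k * A (-τ)) =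
      ν + k / (-k * A (-τ)) * (1 - c * backwardVolume ν c A A' τ) := by
  unfold backwardVolume specificVolume
  field_simp
  ring

/-- The backward trajectory, traversed forwards from parameter `τ`, starts at `σ(τ)` with velocity
`k A(-τ)`. Another trajectory with the same starting `s` differs from it by a homogeneous solution
vanishing at `t = 0`, that is, by the velocity difference times `A`. -/
theorem specificVolume_backwardVolume (h : IsImpulseResponse ν (k * c) A A') (hν : 0 < ν)
    (hk : 0 < k) (hc : 0 < c) (τ r : ℝ) {t : ℝ} (ht : 0 ≤ t) :
    specificVolume ν c A A' (backwardVolume ν c A A' τ) r t =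
      backwardVolume ν c A A' (τ - t) + A t * (r - k * A (-τ)) := by
  have hA := h.continuous
  have hA' := h.continuous'
  have hsub : ∀ t, HasDerivAt (fun t => τ - t) (-1) t := fun t => by
    simpa using (hasDerivAt_id t).const_sub τ
  have hneg : ∀ t, HasDerivAt (fun t => -(τ - t)) 1 t := fun t =>
    (hsub t).neg.congr_deriv (neg_neg 1)
  set s := backwardVolume ν c A A' τ with hs
  have hz : ∀ t, HasDerivAt (fun t => specificVolume ν c A A' s r t -
      (backwardVolume ν c A A' (τ - t) + A t * (r - k * A (-τ))))
      (-(k * c) * A t * (s - 1 / c) + A' t * r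
        - (k * A (-(τ - t)) + A' t * (r - k * A (-τ)))) t := fun t =>
    ((h.hasDerivAt_specificVolume s r t).sub
      (((h.hasDerivAt_backwardVolume hc.ne' (τ - t)).comp t (hsub t)).add
        ((h.hasDerivAt t).mul_const (r - k * A (-τ))))).congr_deriv (by ring)
  have hw : ∀ t, HasDerivAt (fun t => -(k * c) * A t * (s - 1 / c) + A' t * r
        - (k * A (-(τ - t)) + A' t * (r - k * A (-τ)))) _ t := fun t =>
    ((((h.hasDerivAt t).const_mul (-(k * c))).mul_const (s - 1 / c)).add
      ((h.hasDerivAt' t).mul_const r)).sub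
      ((((h.hasDerivAt (-(τ - t))).comp t (hneg t)).const_mul k).add
        ((h.hasDerivAt' t).mul_const (r - k * A (-τ))))
  have := oscillator_eq_zero (T := t) hν (mul_pos hk hc)
    (fun t _ => (hz t).continuousAt.continuousWithinAt)
    (fun t _ => (hw t).continuousAt.continuousWithinAt)
    (fun t _ => hz t) (fun t _ => (hw t).congr_deriv (by
      unfold backwardVolume specificVolume
      field_simp
      ring))
    (by simp [h.specificVolume_zero, h.zero, hs]) (by simp [h.zero, h.one]) ⟨ht, le_rfl⟩
  linarith [this.1]

end IsImpulseResponse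

/-! ### Threshold curves: uniqueness, existence, and positivity of the specific volume -/

theorem IsThresholdCurve.eqOn {ν k c : ℝ} (hk : 0 < k) {P Q : ℝ → ℝ}
    (hP : IsThresholdCurve ν k c P) (hQ : IsThresholdCurve ν k c Q) : EqOn P Q (Ici 0) := by
  intro s hs
  have hs' : (0 : ℝ) < s + 1 := by linarith [mem_Ici.1 hs]
  have hpos : ∀ y ∈ Ioo 0 (s + 1), 0 < P y * Q y := fun s hs =>
    mul_pos ((hP.nonneg s hs.1.le).lt_of_ne' (hP.ode s hs.1).1)
      ((hQ.nonneg s hs.1.le).lt_of_ne' (hQ.ode s hs.1).1)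
  exact eqOn_of_threshold_ode (g := fun s => 1 - c * s) hk hs' (by fun_prop) (by simp)
    (hP.continuousOn.mono Icc_subset_Ici_self) (hQ.continuousOn.mono Icc_subset_Ici_self)
    (by rw [hP.zero, hQ.zero]) hpos (fun s hs => (hP.ode s hs.1).2)
    (fun s hs => (hQ.ode s hs.1).2) ⟨hs, by linarith⟩

theorem IsThresholdLoop.eqOn_one {ν k c S S' : ℝ} (hk : 0 < k) {P₁ P₂ Q₁ Q₂ : ℝ → ℝ}
    (hP : IsThresholdLoop ν k c S P₁ P₂) (hQ : IsThresholdLoop ν k c S' Q₁ Q₂) (hS : S ≤ S') :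
    EqOn P₁ Q₁ (Icc 0 S) := by
  have hsub : Ioo 0 S ⊆ Ioo 0 S' := Ioo_subset_Ioo_right hS
  have hpos : ∀ s ∈ Ioo 0 S, 0 < P₁ s * Q₁ s := fun s hs =>
    mul_pos ((hP.nonneg_one s (Ioo_subset_Icc_self hs)).lt_of_ne' (hP.ode_one s hs).1)
      ((hQ.nonneg_one s (Ioo_subset_Icc_self (hsub hs))).lt_of_ne' (hQ.ode_one s (hsub hs)).1)
  exact eqOn_of_threshold_ode (g := fun s => 1 - c * s) hk hP.pos (by fun_prop) (by simp)
    hP.continuousOn_one (hQ.continuousOn_one.mono (Icc_subset_Icc_right hS))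
    (by rw [hP.zero_one, hQ.zero_one]) hpos (fun s hs => (hP.ode_one s hs).2)
    (fun s hs => (hQ.ode_one s (hsub hs)).2)

/-- If the first loop closed earlier, its arc would coincide with the longer one up to `S`, making
the longer one vanish at an interior point. -/
theorem IsThresholdLoop.le {ν k c S S' : ℝ} (hk : 0 < k) {P₁ P₂ Q₁ Q₂ : ℝ → ℝ}
    (hP : IsThresholdLoop ν k c S P₁ P₂) (hQ : IsThresholdLoop ν k c S' Q₁ Q₂) : S' ≤ S := by
  by_contra! hlt
  have h := hP.eqOn_one hk hQ hlt.le ⟨hP.pos.le, le_rfl⟩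
  rw [hP.end_one] at h
  exact (hQ.ode_one S ⟨hP.pos, hlt⟩).1 h.symm

/-- For the returning arc the driving term at its start is `c S - 1`; the hypothesis `1 < c * S`
makes it positive, as the uniqueness argument at the singular point needs. -/
theorem IsThresholdLoop.unique {ν k c S S' : ℝ} (hk : 0 < k) (hS : 1 < c * S)
    {P₁ P₂ Q₁ Q₂ : ℝ → ℝ} (hP : IsThresholdLoop ν k c S' P₁ P₂)
    (hQ : IsThresholdLoop ν k c S Q₁ Q₂) :
    S' = S ∧ EqOn P₁ Q₁ (Icc 0 S) ∧ EqOn P₂ Q₂ (Icc 0 S) := by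
  obtain rfl : S' = S := le_antisymm (hQ.le hk hP) (hP.le hk hQ)
  refine ⟨rfl, hP.eqOn_one hk hQ le_rfl, ?_⟩
  have hpos : ∀ s ∈ Ioo 0 S', 0 < P₂ s * Q₂ s := fun s hs =>
    mul_pos_of_neg_of_neg
      ((hP.nonpos_two s (Ioo_subset_Icc_self hs)).lt_of_ne (hP.ode_two s hs).1)
      ((hQ.nonpos_two s (Ioo_subset_Icc_self hs)).lt_of_ne (hQ.ode_two s hs).1)
  exact eqOn_of_threshold_ode (g := fun s => c * (S' - s) - 1) hk hP.pos (by fun_prop)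
    (by simpa using hS) hP.continuousOn_two hQ.continuousOn_two
    (by rw [hP.zero_two, hQ.zero_two]) hpos (fun s hs => (hP.ode_two s hs).2)
    (fun s hs => (hQ.ode_two s hs).2)

/-- `Q` is the backward trajectory from the origin written as a graph: `Q (σ τ) = -k A(-τ)`. The
hypothesis `hback` makes `σ` increase and grow at least quadratically, so the graph covers all `s ≥
0`. -/
theorem IsImpulseResponse.exists_thresholdCurve {ν k c : ℝ} {A A' : ℝ → ℝ}
    (h : IsImpulseResponse ν (k * c) A A') (hν : 0 < ν) (hk : 0 < k) (hc : 0 < c)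
    (hpos : ∀ t, 0 < t → 0 < A t) (hback : ∀ t, 0 ≤ t → A (-t) ≤ -t) :
    ∃ Q, IsThresholdCurve ν k c Q ∧ ∀ s r, 0 < s →
      ((∀ t, 0 ≤ t → 0 < specificVolume ν c A A' s r t) ↔ -Q s < r) := by
  set σ := backwardVolume ν c A A' with hσ
  have hσ0 : σ 0 = 0 := h.backwardVolume_zero
  have hσ' : ∀ τ, HasDerivAt σ (-k * A (-τ)) τ := h.hasDerivAt_backwardVolume hc.ne'
  have hσc : Continuous σ := h.continuous_backwardVolume hc.ne'
  have hv : ∀ t, 0 < t → 0 < -k * A (-t) := fun t ht => by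
    nlinarith [hback t ht.le, mul_pos hk ht]
  obtain ⟨hmono, Q, hQc, hQ, hQ'⟩ := exists_graph_of_curve (convex_Ici 0)
    hσ' h.hasDerivAt_backwardRate (by rw [interior_Ici]; exact hv)
  rw [interior_Ici] at hQ'
  have hgrow : ∀ t, 0 ≤ t → k / 2 * t ^ 2 ≤ σ t := fun t ht => by
    have hm : MonotoneOn (fun t => σ t - k / 2 * t ^ 2) (Ici 0) := by
      refine monotoneOn_of_hasDerivWithinAt_nonneg (convex_Ici 0)
        (f' := fun t => -k * A (-t) - k * t) (by fun_prop) (fun t _ => ?_) (fun t ht => ?_)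
      · exact ((hσ' t).sub (((hasDerivAt_id t).pow 2).const_mul (k / 2))).hasDerivWithinAt.congr_deriv
          (by simp; ring)
      · rw [interior_Ici] at ht
        nlinarith [hback t (mem_Ioi.1 ht).le]
    have := hm (mem_Ici.2 le_rfl) (mem_Ici.2 ht) ht
    simp only [hσ0] at this
    nlinarith
  have hnonneg : ∀ t, 0 ≤ σ t := fun t => by
    rcases le_total 0 t with ht | ht
    · exact le_trans (by positivity) (hgrow t ht)
    · have ha : AntitoneOn σ (Iic 0) := by
        refine antitoneOn_of_hasDerivWithinAt_nonpos (convex_Iic 0) hσc.continuousOn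
          (fun t _ => (hσ' t).hasDerivWithinAt) (fun t ht => ?_)
        rw [interior_Iic] at ht
        linarith [mul_pos hk (hpos (-t) (by linarith [mem_Iio.1 ht]))]
      have := ha (mem_Iic.2 ht) (mem_Iic.2 le_rfl) ht
      rwa [hσ0] at this
  have hsurj : ∀ s, 0 ≤ s → ∃ t, 0 ≤ t ∧ σ t = s := fun s hs => by
    -- The time at which the lower bound `k / 2 * t ^ 2` reaches `s`.
    have hT : s ≤ σ (√(2 * s / k)) := by
      refine le_trans (le_of_eq ?_) (hgrow _ (Real.sqrt_nonneg _))
      rw [Real.sq_sqrt (by positivity)]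
      field_simp
    obtain ⟨t, ht, rfl⟩ := intermediate_value_Icc (Real.sqrt_nonneg (2 * s / k))
      hσc.continuousOn ⟨hσ0.trans_le hs, hT⟩
    exact ⟨t, ht.1, rfl⟩
  have hsurj' : ∀ s, 0 < s → ∃ t, 0 < t ∧ σ t = s := fun s hs => by
    obtain ⟨t, ht, rfl⟩ := hsurj s hs.le
    refine ⟨t, ht.lt_of_ne' ?_, rfl⟩
    rintro rfl
    exact hs.ne' hσ0
  have himage : Ici 0 ⊆ σ '' Ici 0 := fun s hs => by
    obtain ⟨t, ht, rfl⟩ := hsurj s hs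
    exact mem_image_of_mem σ ht
  have hQ0 : Q 0 = 0 := by
    have := hQ 0 (mem_Ici.2 le_rfl)
    simpa [hσ0, h.zero] using this
  have hQpos : ∀ s, 0 < s → 0 < Q s := fun s hs => by
    obtain ⟨t, ht, rfl⟩ := hsurj' s hs
    rw [hQ t (mem_Ici.2 ht.le)]
    exact hv t ht
  refine ⟨Q, ⟨hQc.mono himage, fun s hs => ?_, hQ0, fun s hs => ?_⟩, fun s r hs => ?_⟩
  · rcases (mem_Ici.1 hs).eq_or_lt with rfl | hs
    · exact hQ0.ge
    · exact (hQpos s hs).le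
  · refine ⟨(hQpos s hs).ne', ?_⟩
    obtain ⟨t, ht, rfl⟩ := hsurj' s hs
    have hne : A (-t) ≠ 0 := fun h0 => by simpa [h0] using hv t ht
    rw [hQ t (mem_Ici.2 ht.le), hσ, ← IsImpulseResponse.backward_slope hc.ne' hk.ne' hne]
    exact hQ' t ht
  · obtain ⟨τ, hτ, rfl⟩ := hsurj' s hs
    rw [hQ τ (mem_Ici.2 hτ.le)]
    constructor
    · intro H
      -- At `t = τ` the critical trajectory is at the origin, so the specific volume is exactly `A τ
      -- * (r + Q s)`.
      have h1 := H τ hτ.le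
      rw [hσ, h.specificVolume_backwardVolume hν hk hc τ r hτ.le, sub_self, ← hσ, hσ0,
        zero_add] at h1
      have := pos_of_mul_pos_right h1 (hpos τ hτ).le
      linarith
    · intro hr t ht
      rcases ht.eq_or_lt with rfl | ht
      · rwa [h.specificVolume_zero]
      · rw [hσ, h.specificVolume_backwardVolume hν hk hc τ r ht.le]
        have h1 := mul_pos (hpos t ht) (show 0 < r - k * A (-τ) by linarith)
        have h2 := hnonneg (τ - t)
        linarith

theorem pos_of_pos_on_period {V : ℝ → ℝ} {p : ℝ} (hp : 0 < p)
    (h0 : ∀ t, 0 ≤ t → t < p → 0 < V t) (hV : ∀ t, 0 < V t → 0 < V (t + p)) :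
    ∀ t, 0 ≤ t → 0 < V t := by
  have hall : ∀ n : ℕ, ∀ t, 0 ≤ t → t < (n + 1) * p → 0 < V t := by
    intro n
    induction n with
    | zero => intro t ht h1; exact h0 t ht (by simpa using h1)
    | succ n ih =>
      intro t ht h1
      rcases lt_or_ge t p with h2 | h2
      · exact h0 t ht h2
      · have := hV (t - p) (ih _ (by linarith) (by push_cast at h1; linarith))
        rwa [sub_add_cancel] at this
  intro t ht
  obtain ⟨n, hn⟩ := exists_nat_gt (t / p)
  refine hall n t ht ?_
  rw [div_lt_iff₀ hp] at hn
  linarith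

-- The backward trajectory leaves the origin, turns at `τ = P = π / ω` with `σ P = S`, and reaches
-- `s = 0` again at some `T` between `P` and `2 P`. The two monotone pieces are the arcs `Q₁` and
-- `Q₂`. Each bounds the initial rate from one side, according to the sign of `A` at the time when
-- its critical trajectory would hit the origin.
set_option maxHeartbeats 400000 in
theorem exists_thresholdLoop {ν k c ω : ℝ} (hν : 0 < ν) (hk : 0 < k) (hc : 0 < c) (hω : 0 < ω)
    (hω2 : k * c - ν ^ 2 / 4 = ω ^ 2) :
    ∃ A A' : ℝ → ℝ, IsImpulseResponse ν (k * c) A A' ∧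
    ∃ S Q₁ Q₂, IsThresholdLoop ν k c S Q₁ Q₂ ∧ 1 < c * S ∧ ∀ s r, 0 < s →
      ((∀ t, 0 ≤ t → 0 < specificVolume ν c A A' s r t) ↔
        s < S ∧ -Q₁ s < r ∧ r < -Q₂ (S - s)) := by
  have h := isImpulseResponse_sin hω.ne' hω2
  set A := fun t => Real.exp (-(ν / 2) * t) * (Real.sin (ω * t) / ω) with hA
  set A' := fun t => Real.exp (-(ν / 2) * t) *
    (Real.cos (ω * t) - ν / 2 * (Real.sin (ω * t) / ω)) with hA'
  refine ⟨A, A', h, ?_⟩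
  set P := Real.pi / ω with hP
  have hP0 : 0 < P := div_pos Real.pi_pos hω
  have hωP : ω * P = Real.pi := by rw [hP]; field_simp
  have hApos : ∀ t, 0 < t → t < P → 0 < A t := fun t h0 h1 => by
    have : 0 < Real.sin (ω * t) := Real.sin_pos_of_pos_of_lt_pi (by positivity)
      (by rw [← hωP]; exact mul_lt_mul_of_pos_left h1 hω)
    simp only [hA]; positivity
  have hAshift : ∀ t, A (t - P) = -(Real.exp (ν / 2 * P) * A t) := fun t => by
    simp only [hA, mul_sub, hωP, Real.sin_sub_pi]
    rw [show -(ν / 2) * t - -(ν / 2) * P = ν / 2 * P + -(ν / 2) * t by ring, Real.exp_add]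
    ring
  have hA'shift : ∀ t, A' (t - P) = -(Real.exp (ν / 2 * P) * A' t) := fun t => by
    simp only [hA', mul_sub, hωP, Real.sin_sub_pi, Real.cos_sub_pi]
    rw [show -(ν / 2) * t - -(ν / 2) * P = ν / 2 * P + -(ν / 2) * t by ring, Real.exp_add]
    ring
  set E := Real.exp (ν / 2 * P) with hE
  have hE0 : 0 < E := Real.exp_pos _
  have hE1 : 1 < E := Real.one_lt_exp_iff.2 (by positivity)
  -- From here on only the sign of `A` on a half-period and the half-period shift rules matter.
  clear_value A A' P E
  clear hA hA'
  have hApos' : ∀ t, 0 < t → t < P → A (-t) < 0 := fun t h0 h1 => by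
    have h2 := hAshift (P - t)
    rw [show P - t - P = -t by ring] at h2
    rw [h2]
    have := mul_pos hE0 (hApos (P - t) (by linarith) (by linarith))
    linarith
  have hAneg : ∀ t, P < t → t < 2 * P → A t < 0 := fun t h0 h1 => by
    have h2 := hAshift t
    have h3 := hApos (t - P) (by linarith) (by linarith)
    by_contra! h4
    have := mul_nonneg hE0.le h4
    linarith
  have hAneg' : ∀ t, P < t → t < 2 * P → 0 < A (-t) := fun t h0 h1 => by
    have h2 := hAshift (P - t)
    rw [show P - t - P = -t by ring, show P - t = -(t - P) by ring] at h2
    have h3 := mul_pos_of_neg_of_neg (neg_lt_zero.2 hE0) (hApos' (t - P) (by linarith) (by linarith))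
    rw [h2]; linarith
  have hAP' : A (-P) = 0 := by
    have := hAshift 0
    rwa [h.zero, zero_sub, mul_zero, neg_zero] at this
  set V := specificVolume ν c A A' with hV
  -- Half a period reflects the deviation from the equilibrium `1/c` and scales it: by `-E`
  -- backwards in time, by `-1/E` forwards.
  have hVshift : ∀ s r t, V s r (t - P) - 1 / c = -E * (V s r t - 1 / c) := fun s r t => by
    simp only [hV, specificVolume, hAshift, hA'shift]; ring
  set σ := backwardVolume ν c A A' with hσ
  have hσ0 : σ 0 = 0 := h.backwardVolume_zero
  have hσ' : ∀ τ, HasDerivAt σ (-k * A (-τ)) τ := h.hasDerivAt_backwardVolume hc.ne'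
  have hσc : Continuous σ := h.continuous_backwardVolume hc.ne'
  have hσshift : ∀ t, σ (t + P) - 1 / c = -E * (σ t - 1 / c) := fun t => by
    have := hVshift 0 0 (-t)
    rwa [show -t - P = -(t + P) by ring] at this
  set S := σ P with hS
  -- Reflecting `σ 0 = 0` through `1/c` gives `S = (1 + E) / c`; reflecting once more makes `σ (2 *
  -- P)` negative.
  have hSE : S - 1 / c = E / c := by
    have := hσshift 0
    rw [zero_add, hσ0] at this
    rw [hS, this]; ring
  have hcS : 1 < c * S := by
    have : S = 1 / c + E / c := by linarith
    rw [this]; field_simp; linarith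
  have hS0 : 0 < S := by
    by_contra! h0
    nlinarith
  clear_value σ V
  have h2P : σ (2 * P) < 0 := by
    have := hσshift P
    rw [← two_mul, ← hS, hSE] at this
    have h1 : σ (2 * P) = (1 - E ^ 2) / c := by
      have : σ (2 * P) = 1 / c + -E * (E / c) := by linarith
      rw [this]; ring
    rw [h1]
    exact div_neg_of_neg_of_pos (by nlinarith) hc
  obtain ⟨T, hT, hσT⟩ : ∃ T ∈ Icc P (2 * P), σ T = 0 :=
    intermediate_value_Icc' (by linarith) hσc.continuousOn ⟨h2P.le, hS0.le⟩
  have hT1 : P < T := hT.1.lt_of_ne (by rintro rfl; exact hS0.ne' hσT)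
  have hT2 : T < 2 * P := hT.2.lt_of_ne (by rintro rfl; exact h2P.ne hσT)
  obtain ⟨hmono₁, Q₁, hQ₁c, hQ₁, hQ₁'⟩ := exists_graph_of_curve (convex_Icc 0 P)
    hσ' h.hasDerivAt_backwardRate (fun t ht => by
      rw [interior_Icc] at ht
      linarith [mul_pos hk (neg_pos.2 (hApos' t ht.1 ht.2))])
  obtain ⟨hmono₂, Q₂, hQ₂c, hQ₂, hQ₂'⟩ := exists_graph_of_curve (convex_Icc P T)
    (fun t => (hσ' t).const_sub S) h.hasDerivAt_backwardRate (fun t ht => by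
      rw [interior_Icc] at ht
      linarith [mul_pos hk (hAneg' t ht.1 (ht.2.trans hT2))])
  rw [interior_Icc] at hQ₁' hQ₂'
  have hnonneg : ∀ t, -P ≤ t → t ≤ P → 0 ≤ σ t := fun t h0 h1 => by
    rcases le_total 0 t with ht | ht
    · have := hmono₁.monotoneOn ⟨le_rfl, hP0.le⟩ ⟨ht, h1⟩ ht
      rwa [hσ0] at this
    · have ha : AntitoneOn σ (Icc (-P) 0) := by
        refine antitoneOn_of_hasDerivWithinAt_nonpos (convex_Icc _ _) hσc.continuousOn
          (fun t _ => (hσ' t).hasDerivWithinAt) (fun t ht => ?_)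
        rw [interior_Icc] at ht
        linarith [mul_pos hk (hApos (-t) (by linarith [ht.2]) (by linarith [ht.1]))]
      have := ha ⟨h0, ht⟩ ⟨by linarith, le_rfl⟩ ht
      rwa [hσ0] at this
  have hsurj₁ : ∀ s ∈ Icc 0 S, ∃ t ∈ Icc 0 P, σ t = s := fun s hs =>
    intermediate_value_Icc hP0.le hσc.continuousOn (by rwa [hσ0])
  have hsurj₂ : ∀ s ∈ Icc 0 S, ∃ t ∈ Icc P T, σ t = s := fun s hs =>
    intermediate_value_Icc' hT1.le hσc.continuousOn (by rwa [hσT])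
  have hsurj₁' : ∀ s ∈ Ioo 0 S, ∃ t ∈ Ioo 0 P, σ t = s := fun s hs => by
    obtain ⟨t, ht, rfl⟩ := hsurj₁ s (Ioo_subset_Icc_self hs)
    refine ⟨t, ⟨ht.1.lt_of_ne' ?_, ht.2.lt_of_ne ?_⟩, rfl⟩ <;> rintro rfl
    · exact hs.1.ne' hσ0
    · exact hs.2.ne rfl
  have hsurj₂' : ∀ s ∈ Ioo 0 S, ∃ t ∈ Ioo P T, σ t = s := fun s hs => by
    obtain ⟨t, ht, rfl⟩ := hsurj₂ s (Ioo_subset_Icc_self hs)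
    refine ⟨t, ⟨ht.1.lt_of_ne' ?_, ht.2.lt_of_ne ?_⟩, rfl⟩ <;> rintro rfl
    · exact hs.2.ne rfl
    · exact hs.1.ne' hσT
  have hloop : IsThresholdLoop ν k c S Q₁ Q₂ := by
    refine ⟨hS0, hQ₁c.mono hsurj₁, fun s hs => ?_, ?_, ?_, fun s hs => ?_,
      hQ₂c.mono (fun s hs => ?_), fun s hs => ?_, ?_, fun s hs => ?_⟩
    · obtain ⟨t, ht, rfl⟩ := hsurj₁ s hs
      rw [hQ₁ t ht]
      rcases ht.1.eq_or_lt with rfl | h0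
      · simp [h.zero]
      rcases ht.2.eq_or_lt with rfl | h1
      · simp [hAP']
      · linarith [mul_pos hk (neg_pos.2 (hApos' t h0 h1))]
    · have := hQ₁ 0 ⟨le_rfl, hP0.le⟩
      simpa [hσ0, h.zero] using this
    · rw [hS, hQ₁ P ⟨hP0.le, le_rfl⟩]; simp [hAP']
    · obtain ⟨t, ht, rfl⟩ := hsurj₁' s hs
      have hne := (hApos' t ht.1 ht.2).ne
      rw [hQ₁ t (Ioo_subset_Icc_self ht)]
      refine ⟨mul_ne_zero (neg_ne_zero.2 hk.ne') hne, ?_⟩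
      rw [hσ, ← IsImpulseResponse.backward_slope hc.ne' hk.ne' hne, ← hσ]
      exact hQ₁' t ht
    · obtain ⟨t, ht, hts⟩ := hsurj₂ (S - s) ⟨by linarith [hs.2], by linarith [hs.1]⟩
      exact ⟨t, ht, (congrArg (S - ·) hts).trans (by ring)⟩
    · obtain ⟨t, ht, hts⟩ := hsurj₂ (S - s) ⟨by linarith [hs.2], by linarith [hs.1]⟩
      obtain rfl : S - σ t = s := by rw [hts]; ring
      rw [hQ₂ t ht]
      rcases ht.1.eq_or_lt with rfl | h0
      · simp [hAP']
      · linarith [mul_pos hk (hAneg' t h0 (ht.2.trans_lt hT2))]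
    · have := hQ₂ P ⟨le_rfl, hT1.le⟩
      simpa [hAP', hS] using this
    · obtain ⟨t, ht, hts⟩ := hsurj₂' (S - s) ⟨by linarith [hs.2], by linarith [hs.1]⟩
      obtain rfl : S - σ t = s := by rw [hts]; ring
      have hne := (hAneg' t ht.1 (ht.2.trans hT2)).ne'
      rw [hQ₂ t (Ioo_subset_Icc_self ht)]
      refine ⟨mul_ne_zero (neg_ne_zero.2 hk.ne') hne, (hQ₂' t ht).congr_deriv ?_⟩
      rw [div_neg, IsImpulseResponse.backward_slope (ν := ν) hc.ne' hk.ne' hne, ← hσ]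
      ring
  refine ⟨S, Q₁, Q₂, hloop, hcS, fun s r hs => ?_⟩
  -- At `t = P` the impulse response vanishes, so the initial rate is irrelevant: `S - s = E * V s r
  -- P`.
  have hVP : ∀ s r, 0 < V s r P ↔ s < S := fun s r => by
    have h1 := hVshift s r P
    rw [sub_self, hV, h.specificVolume_zero] at h1
    rw [← hV] at h1
    have h2 : S - s = E * V s r P := by
      have : S = 1 / c + E / c := by linarith
      rw [this]; linear_combination -h1
    constructor
    · intro h3
      have := mul_pos hE0 h3
      linarith
    · intro h3
      exact pos_of_mul_pos_right (by linarith : 0 < E * V s r P) hE0.le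
  constructor
  · intro H
    have hsS := (hVP s r).1 (H P hP0.le)
    refine ⟨hsS, ?_, ?_⟩
    · obtain ⟨τ, hτ, rfl⟩ := hsurj₁' s ⟨hs, hsS⟩
      have h1 := H τ hτ.1.le
      rw [hV, hσ, h.specificVolume_backwardVolume hν hk hc τ r hτ.1.le, sub_self, ← hσ, hσ0,
        zero_add] at h1
      have := pos_of_mul_pos_right h1 (hApos τ hτ.1 hτ.2).le
      rw [hQ₁ τ (Ioo_subset_Icc_self hτ)]
      linarith
    · obtain ⟨τ, hτ, rfl⟩ := hsurj₂' s ⟨hs, hsS⟩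
      have hτ0 : 0 ≤ τ := hP0.le.trans hτ.1.le
      have h1 := H τ hτ0
      rw [hV, hσ, h.specificVolume_backwardVolume hν hk hc τ r hτ0, sub_self, ← hσ, hσ0,
        zero_add] at h1
      have h2 := hAneg τ hτ.1 (hτ.2.trans hT2)
      rw [hQ₂ τ (Ioo_subset_Icc_self hτ)]
      by_contra! h3
      have := mul_nonneg (neg_nonneg.2 h2.le) (show 0 ≤ r - k * A (-τ) by linarith)
      linarith
  · rintro ⟨hsS, hr1, hr2⟩
    obtain ⟨τ₁, hτ₁, hτs₁⟩ := hsurj₁' s ⟨hs, hsS⟩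
    obtain ⟨τ₂, hτ₂, hτs₂⟩ := hsurj₂' s ⟨hs, hsS⟩
    have hr1' : 0 < r - k * A (-τ₁) := by
      rw [← hτs₁, hQ₁ τ₁ (Ioo_subset_Icc_self hτ₁)] at hr1; linarith
    have hr2' : r - k * A (-τ₂) < 0 := by
      rw [← hτs₂, hQ₂ τ₂ (Ioo_subset_Icc_self hτ₂)] at hr2; linarith
    have hperiod : ∀ t, 0 ≤ t → t < 2 * P → 0 < V s r t := fun t h0 h2 => by
      rcases h0.eq_or_lt with rfl | h0'
      · rwa [hV, h.specificVolume_zero]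
      rcases lt_trichotomy t P with h1 | rfl | h1
      · rw [← hτs₁, hV, hσ, h.specificVolume_backwardVolume hν hk hc τ₁ r h0, ← hσ]
        -- Both arcs are used only at parameters in `[-P, P]`, where `σ ≥ 0`; after `T` the backward
        -- trajectory itself becomes negative.
        have := hnonneg (τ₁ - t) (by linarith [hτ₁.1]) (by linarith [hτ₁.2])
        have := mul_pos (hApos t h0' h1) hr1'
        linarith
      · exact (hVP s r).2 hsS
      · rw [← hτs₂, hV, hσ, h.specificVolume_backwardVolume hν hk hc τ₂ r h0, ← hσ]
        have := hnonneg (τ₂ - t) (by linarith [hτ₂.1]) (by linarith [hτ₂.2])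
        have := mul_pos_of_neg_of_neg (hAneg t h1 h2) hr2'
        linarith
    -- After a full period the deviation from `1/c` is divided by `E ^ 2 > 1`, so the new value is a
    -- convex combination of the old one and `1/c`.
    have hshift : ∀ t, 0 < V s r t → 0 < V s r (t + 2 * P) := fun t ht => by
      have h1 := hVshift s r (t + P)
      have h2 := hVshift s r (t + 2 * P)
      rw [add_sub_cancel_right] at h1
      rw [show t + 2 * P - P = t + P by ring, ] at h2
      rw [h2] at h1
      have h3 : E ^ 2 * V s r (t + 2 * P) = V s r t + (E ^ 2 - 1) * (1 / c) := by
        linear_combination -h1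
      have h4 : 0 < (E ^ 2 - 1) * (1 / c) := mul_pos (by nlinarith) (by positivity)
      exact pos_of_mul_pos_right (by linarith : 0 < E ^ 2 * V s r (t + 2 * P)) (by positivity)
    exact pos_of_pos_on_period (by positivity) hperiod hshift

/-! ### Classical solutions continued across `t = 0` -/

theorem eq_left_of_hasDerivAt_zero {f : ℝ → ℝ} {T : ℝ} (hf : ContinuousOn f (Icc 0 T))
    (hf' : ∀ t ∈ Ioo 0 T, HasDerivAt f 0 t) {t : ℝ} (ht : t ∈ Icc 0 T) : f t = f 0 := by
  rcases ht.1.eq_or_lt with rfl | h0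
  · rfl
  obtain ⟨s, -, hs⟩ := exists_hasDerivAt_eq_slope f (fun _ => 0) h0
    (hf.mono (Icc_subset_Icc_right ht.2)) fun s hs => hf' s ⟨hs.1, hs.2.trans_le ht.2⟩
  rcases div_eq_zero_iff.1 hs.symm with h | h <;> linarith

/-- `fx` and `ft` are continuous partial derivatives of the continuous function `f`, up to `t = 0`
in the case of `fx`. Everything is continuous on the whole plane, for convenience. -/
structure HasPartials (f fx ft : ℝ → ℝ → ℝ) : Prop where
  cont : Continuous fun p : ℝ × ℝ => f p.1 p.2
  cont_x : Continuous fun p : ℝ × ℝ => fx p.1 p.2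
  cont_t : Continuous fun p : ℝ × ℝ => ft p.1 p.2
  hasDerivAt_x : ∀ x t, HasDerivAt (fun y => f y t) (fx x t) x
  hasFDerivAt : ∀ x t, 0 < t → HasFDerivAt (fun p : ℝ × ℝ => f p.1 p.2)
    (fx x t • ContinuousLinearMap.fst ℝ ℝ ℝ + ft x t • ContinuousLinearMap.snd ℝ ℝ ℝ) (x, t)

theorem HasPartials.hasDerivAt_comp {f fx ft : ℝ → ℝ → ℝ} (h : HasPartials f fx ft) {X : ℝ → ℝ}
    {X' t : ℝ} (ht : 0 < t) (hX : HasDerivAt X X' t) :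
    HasDerivAt (fun s => f (X s) s) (fx (X t) t * X' + ft (X t) t) t := by
  have hXs : HasDerivAt (fun s => (X s, s)) (X', 1) t := hX.prodMk (hasDerivAt_id t)
  have := HasFDerivAt.comp_hasDerivAt (f := fun s => (X s, s)) t (h.hasFDerivAt (X t) t ht) hXs
  exact this.congr_deriv (by simp)

theorem HasPartials.hasDerivAt_t {f fx ft : ℝ → ℝ → ℝ} (h : HasPartials f fx ft) (x : ℝ) {t : ℝ}
    (ht : 0 < t) : HasDerivAt (fun s => f x s) (ft x t) t :=
  (h.hasDerivAt_comp ht (hasDerivAt_const t x)).congr_deriv (by simp)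

/-- Freezing the value at `t = 0` for negative times turns regularity up to the boundary into
continuity on the whole plane. The partial derivatives are extended by the same freezing, so `ft`
need not be the time derivative for `t ≤ 0`. -/
theorem exists_hasPartials {f : ℝ → ℝ → ℝ}
    (hf : ContDiffOn ℝ 1 (fun p : ℝ × ℝ => f p.1 p.2) (univ ×ˢ Ici 0)) :
    ∃ fx ft, HasPartials (fun x t => f x (max t 0)) fx ft := by
  set D : Set (ℝ × ℝ) := univ ×ˢ Ici 0 with hD
  set F := fun p : ℝ × ℝ => f p.1 p.2 with hF
  have huD : UniqueDiffOn ℝ D := uniqueDiffOn_univ.prod (uniqueDiffOn_Ici 0)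
  have hF' : ContinuousOn (fderivWithin ℝ F D) D := hf.continuousOn_fderivWithin huD le_rfl
  have hproj : Continuous fun p : ℝ × ℝ => (p.1, max p.2 0) := by fun_prop
  have hmem : ∀ p : ℝ × ℝ, (p.1, max p.2 0) ∈ D := fun p => ⟨mem_univ _, mem_Ici.2 (le_max_right _ _)⟩
  have hFc := hf.continuousOn.comp_continuous hproj hmem
  have hF'c := hF'.comp_continuous hproj hmem
  have hdiff : ∀ p ∈ D, HasFDerivWithinAt F (fderivWithin ℝ F D p) D p := fun p hp =>
    ((hf p hp).differentiableWithinAt one_ne_zero).hasFDerivWithinAt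
  refine ⟨fun x t => fderivWithin ℝ F D (x, max t 0) (1, 0),
    fun x t => fderivWithin ℝ F D (x, max t 0) (0, 1), hFc, hF'c.clm_apply continuous_const,
    hF'c.clm_apply continuous_const, fun x t => ?_, fun x t ht => ?_⟩
  · have h1 : HasDerivWithinAt (fun y : ℝ => (y, max t 0)) (1, 0) univ x :=
      ((hasDerivAt_id x).prodMk (hasDerivAt_const x (max t 0))).hasDerivWithinAt
    have := (hdiff (x, max t 0) (hmem (x, t))).comp_hasDerivWithinAt x h1 fun y _ => hmem (y, t)
    rwa [hasDerivWithinAt_univ] at this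
  · have hn : D ∈ 𝓝 (x, t) := prod_mem_nhds univ_mem (Ici_mem_nhds ht)
    have h1 := (hdiff (x, t) (mem_of_mem_nhds hn)).hasFDerivAt hn
    have h2 : HasFDerivAt (fun p : ℝ × ℝ => f p.1 (max p.2 0)) (fderivWithin ℝ F D (x, t)) (x, t) := by
      refine h1.congr_of_eventuallyEq ?_
      filter_upwards [hn] with p hp
      simp only [hF]
      rw [max_eq_left hp.2]
    refine h2.congr_fderiv ?_
    simp only [max_eq_left ht.le]
    ext <;> simp

/-- A solution of the Euler-Poisson system, together with its partial derivatives and the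
field `E = φ_x`, continued in time beyond `t = 0` in a continuous way. -/
structure IsFlowSolution (ν k c : ℝ) (ρ ρx ρt u ux ut E : ℝ → ℝ → ℝ) : Prop where
  density : HasPartials ρ ρx ρt
  velocity : HasPartials u ux ut
  mass : ∀ x t, 0 < t → ρt x t + (ρx x t * u x t + ρ x t * ux x t) = 0
  momentum : ∀ x t, ut x t + ux x t * u x t = -k * E x t - ν * u x t
  cont_field : Continuous fun p : ℝ × ℝ => E p.1 p.2
  poisson : ∀ x t, 0 < t → HasDerivAt (fun y => E y t) (c - ρ x t) x
  field_atTop : ∀ t, 0 < t → Tendsto (fun x => E x t) atTop (𝓝 0)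

/-- The potential is given separately for each `t > 0`, with no regularity in time. Solving the
momentum equation for `φ_x` yields a version of the field that is continuous in both variables down
to `t = 0`. -/
theorem IsGlobalSolution.exists_isFlowSolution {ν k c : ℝ} (hk : 0 < k) {ρ₀ u₀ : ℝ → ℝ}
    {ρ u : ℝ → ℝ → ℝ} (h : IsGlobalSolution ν k c ρ₀ u₀ ρ u) :
    ∃ ρx ρt ux ut E, IsFlowSolution ν k c (fun x t => ρ x (max t 0)) ρx ρt
      (fun x t => u x (max t 0)) ux ut E := by
  obtain ⟨ρx, ρt, hρ⟩ := exists_hasPartials h.density_contDiffOn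
  obtain ⟨ux, ut, hu⟩ := exists_hasPartials h.velocity_contDiffOn
  obtain ⟨φ, hφ⟩ := h.momentum_poisson
  have hev : ∀ (f : ℝ → ℝ → ℝ) (x t : ℝ), 0 < t →
      (fun s => f x s) =ᶠ[𝓝 t] fun s => f x (max s 0) := fun f x t ht => by
    filter_upwards [Ioi_mem_nhds ht] with s hs
    rw [max_eq_left (mem_Ioi.1 hs).le]
  have hut : ∀ x t, 0 < t → deriv (fun s => u x s) t = ut x t := fun x t ht =>
    ((hu.hasDerivAt_t x ht).congr_of_eventuallyEq (hev u x t ht)).deriv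
  have hρt : ∀ x t, 0 < t → deriv (fun s => ρ x s) t = ρt x t := fun x t ht =>
    ((hρ.hasDerivAt_t x ht).congr_of_eventuallyEq (hev ρ x t ht)).deriv
  have hρx : ∀ x t, 0 < t → HasDerivAt (fun y => ρ y t) (ρx x t) x := fun x t ht => by
    simpa only [max_eq_left ht.le] using hρ.hasDerivAt_x x t
  have hux : ∀ x t, 0 < t → HasDerivAt (fun y => u y t) (ux x t) x := fun x t ht => by
    simpa only [max_eq_left ht.le] using hu.hasDerivAt_x x t
  have hE : ∀ x t, 0 < t →
      -(ut x t + ux x t * u x (max t 0) + ν * u x (max t 0)) / k = deriv (fun y => φ y t) x := by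
    intro x t ht
    have := ((hφ t ht).2.2.2 x).1
    rw [hut x t ht, (hux x t ht).deriv] at this
    rw [max_eq_left ht.le, div_eq_iff hk.ne']
    linarith
  refine ⟨ρx, ρt, ux, ut,
    fun x t => -(ut x t + ux x t * u x (max t 0) + ν * u x (max t 0)) / k,
    hρ, hu, fun x t ht => ?_, fun x t => ?_, ?_, fun x t ht => ?_, fun t ht => ?_⟩
  · have := h.mass x t ht
    have hd : deriv (fun y => ρ y t * u y t) x = ρx x t * u x t + ρ x t * ux x t :=
      ((hρx x t ht).mul (hux x t ht)).deriv
    rw [hρt x t ht, hd] at this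
    simpa only [max_eq_left ht.le] using this
  · field_simp
    ring
  · have h1 := hu.cont
    have h2 := hu.cont_x
    have h3 := hu.cont_t
    exact ((h3.add (h2.mul h1)).add (h1.const_mul ν)).neg.div_const k
  · simp only [hE _ t ht]
    have h1 : DifferentiableAt ℝ (deriv fun y => φ y t) x :=
      (((hφ t ht).1.iterate_deriv' 1 1).differentiable one_ne_zero) x
    have h2 := ((hφ t ht).2.2.2 x).2
    rw [max_eq_left ht.le]
    exact h1.hasDerivAt.congr_deriv (by linarith)
  · simp only [hE _ t ht]
    exact (hφ t ht).2.2.1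

/-! ### The electric field along characteristics -/

namespace IsFlowSolution

variable {ν k c : ℝ} {ρ ρx ρt u ux ut E : ℝ → ℝ → ℝ}

/-- The Poisson equation holds only for `t > 0`; both sides are continuous in `t`, which adds `t =
0`. -/
theorem field_eq (h : IsFlowSolution ν k c ρ ρx ρt u ux ut E) (x : ℝ) {t : ℝ} (ht : 0 ≤ t) :
    E x t - E 0 t = ∫ y in 0..x, (c - ρ y t) := by
  have hρ := h.density.cont
  have hE := h.cont_field
  have h1 : EqOn (fun t => E x t - E 0 t) (fun t => ∫ y in 0..x, (c - ρ y t)) (Ioi 0) := by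
    intro t ht
    refine (intervalIntegral.integral_eq_sub_of_hasDerivAt (fun y _ => h.poisson y t ht) ?_).symm
    exact Continuous.intervalIntegrable (by fun_prop) _ _
  have h2 := h1.closure (by fun_prop)
    (intervalIntegral.continuous_parametric_intervalIntegral_of_continuous'
      (f := fun t y => c - ρ y t) (by fun_prop) 0 x)
  rw [closure_Ioi] at h2
  exact h2 ht

theorem hasDerivAt_field_initial (h : IsFlowSolution ν k c ρ ρx ρt u ux ut E) (x : ℝ) :
    HasDerivAt (fun y => E y 0) (c - ρ x 0) x := by
  have hρ := h.density.cont
  have h1 : (fun y => E y 0) = fun x => E 0 0 + ∫ y in 0..x, (c - ρ y 0) := by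
    funext x
    rw [← h.field_eq x le_rfl]
    ring
  rw [h1]
  exact ((show Continuous fun y => c - ρ y 0 by fun_prop).integral_hasStrictDerivAt
    0 x).hasDerivAt.const_add _

/-- Change of the field along a characteristic relative to the origin. -/
theorem hasDerivAt_field_sub (h : IsFlowSolution ν k c ρ ρx ρt u ux ut E) {X : ℝ → ℝ} {T : ℝ}
    (hX : ∀ t ∈ Ioo 0 T, HasDerivAt X (u (X t) t) t) {t : ℝ} (ht : t ∈ Ioo 0 T) :
    HasDerivAt (fun s => E (X s) s - E 0 s) (c * u (X t) t - ρ 0 t * u 0 t) t := by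
  have hρ := h.density.cont
  have hρx := h.density.cont_x
  have hρt := h.density.cont_t
  have hu := h.velocity.cont
  have hux := h.velocity.cont_x
  have hXc : ∀ s ∈ Ioo 0 T, ContinuousAt X s := fun s hs => (hX s hs).continuousAt
  obtain ⟨a, ha0, hat⟩ := exists_between ht.1
  obtain ⟨b, htb, hbT⟩ := exists_between ht.2
  have hab : Icc a b ⊆ Ioo 0 T := fun s hs => ⟨ha0.trans_le hs.1, hs.2.trans_lt hbT⟩
  have hXon : ContinuousOn X (Icc a b) := fun s hs => (hXc s (hab hs)).continuousWithinAt
  -- The substitution `y = θ X(s)` fixes the domain of `∫ y in 0..X, (c - ρ)` to `[0, 1]`, so that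
  -- it can be differentiated under the integral sign; `G` is the time derivative of `ρ (θ X(s)) s`.
  set G : ℝ → ℝ → ℝ := fun s θ => ρx (θ * X s) s * (θ * u (X s) s) + ρt (θ * X s) s with hG
  have hXfst : ContinuousOn (fun p : ℝ × ℝ => X p.1) (Icc a b ×ˢ Icc 0 1) :=
    hXon.comp continuousOn_fst fun p hp => hp.1
  have hGc : ContinuousOn (fun p : ℝ × ℝ => G p.1 p.2) (Icc a b ×ˢ Icc 0 1) := by
    have h1 : ContinuousOn (fun p : ℝ × ℝ => (p.2 * X p.1, p.1)) (Icc a b ×ˢ Icc 0 1) :=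
      (continuousOn_snd.mul hXfst).prodMk continuousOn_fst
    have h2 : ContinuousOn (fun p : ℝ × ℝ => (X p.1, p.1)) (Icc a b ×ˢ Icc 0 1) :=
      hXfst.prodMk continuousOn_fst
    exact ((hρx.comp_continuousOn h1).mul (continuousOn_snd.mul (hu.comp_continuousOn h2))).add
      (hρt.comp_continuousOn h1)
  obtain ⟨M, hM⟩ := (isCompact_Icc.prod isCompact_Icc).exists_bound_of_continuousOn hGc
  have hGt : Continuous (G t) := by
    have h1 : Continuous fun θ : ℝ => (θ * X t, t) := by fun_prop
    have h2 : Continuous fun θ : ℝ => θ * u (X t) t := by fun_prop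
    exact ((hρx.comp h1).mul h2).add (hρt.comp h1)
  have hρθ : Continuous fun θ : ℝ => ρ (θ * X t) t := by
    have h1 : Continuous fun θ : ℝ => (θ * X t, t) := by fun_prop
    exact hρ.comp h1
  have hint := (intervalIntegral.hasDerivAt_integral_of_dominated_loc_of_deriv_le
    (μ := MeasureTheory.volume) (a := 0) (b := 1) (F := fun s θ => c - ρ (θ * X s) s)
    (F' := fun s θ => -G s θ) (s := Icc a b) (bound := fun _ => M) (Icc_mem_nhds hat htb)
    (Eventually.of_forall fun s => Continuous.aestronglyMeasurable (by
      have h1 : Continuous fun θ : ℝ => (θ * X s, s) := by fun_prop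
      exact continuous_const.sub (hρ.comp h1)))
    ((continuous_const.sub hρθ).intervalIntegrable _ _) hGt.neg.aestronglyMeasurable
    (Eventually.of_forall fun θ hθ s hs => by
      rw [norm_neg]
      rw [uIoc_of_le zero_le_one] at hθ
      exact hM (s, θ) ⟨hs, hθ.1.le, hθ.2⟩)
    intervalIntegrable_const
    (Eventually.of_forall fun θ _ s hs =>
      (h.density.hasDerivAt_comp (hab hs).1 ((hX s (hab hs)).const_mul θ)).const_sub c)).2
  -- By the mass equation the integrand is, up to the term `u(X) ρ`, an exact `θ`-derivative. Only
  -- the fluxes at the two ends survive.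
  have hflux : X t * ∫ θ in (0:ℝ)..1, G t θ =
      ρ 0 t * u 0 t - u (X t) t * ∫ θ in (0:ℝ)..1, ρ (θ * X t) t := by
    have h1 : ∀ θ : ℝ, HasDerivAt
        (fun θ => θ * u (X t) t * ρ (θ * X t) t - ρ (θ * X t) t * u (θ * X t) t)
        (u (X t) t * ρ (θ * X t) t + X t * G t θ) θ := fun θ => by
      have hθ : HasDerivAt (fun θ => θ * X t) (X t) θ := by
        simpa using (hasDerivAt_id θ).mul_const (X t)
      have hθu : HasDerivAt (fun θ => θ * u (X t) t) (u (X t) t) θ := by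
        simpa using (hasDerivAt_id θ).mul_const (u (X t) t)
      have hρ1 : HasDerivAt (fun θ => ρ (θ * X t) t) (ρx (θ * X t) t * X t) θ :=
        HasDerivAt.comp (h₂ := fun y => ρ y t) θ (h.density.hasDerivAt_x (θ * X t) t) hθ
      have hu1 : HasDerivAt (fun θ => u (θ * X t) t) (ux (θ * X t) t * X t) θ :=
        HasDerivAt.comp (h₂ := fun y => u y t) θ (h.velocity.hasDerivAt_x (θ * X t) t) hθ
      refine ((hθu.mul hρ1).sub (hρ1.mul hu1)).congr_deriv ?_
      have hm := h.mass (θ * X t) t ht.1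
      simp only [hG]
      linear_combination (-X t) * hm
    have h2 := intervalIntegral.integral_eq_sub_of_hasDerivAt (a := 0) (b := 1)
      (fun θ _ => h1 θ)
      (Continuous.intervalIntegrable ((hρθ.const_mul _).add (hGt.const_mul _)) _ _)
    rw [intervalIntegral.integral_add ((hρθ.const_mul _).intervalIntegrable _ _)
      ((hGt.const_mul _).intervalIntegrable _ _), intervalIntegral.integral_const_mul,
      intervalIntegral.integral_const_mul] at h2
    simp only [one_mul, zero_mul, zero_sub] at h2
    linarith
  have hK : (fun s => E (X s) s - E 0 s) =ᶠ[𝓝 t]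
      fun s => X s * ∫ θ in (0:ℝ)..1, (c - ρ (θ * X s) s) := by
    filter_upwards [Ioi_mem_nhds ht.1] with s hs
    rw [h.field_eq (X s) (mem_Ioi.1 hs).le,
      intervalIntegral.mul_integral_comp_mul_right (f := fun y => c - ρ y s), zero_mul, one_mul]
  refine (((hX t ht).mul hint).congr_of_eventuallyEq hK).congr_deriv ?_
  rw [intervalIntegral.integral_neg, mul_neg, hflux,
    intervalIntegral.integral_sub intervalIntegrable_const (hρθ.intervalIntegrable _ _)]
  simp
  ring

end IsFlowSolution

/-! ### Characteristics and limits of the initial field -/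

/-- `X` is the characteristic of the velocity field `u` that starts at `x₀`, up to time `T`. -/
structure IsCharacteristic (u : ℝ → ℝ → ℝ) (T x₀ : ℝ) (X : ℝ → ℝ) : Prop where
  continuousOn : ContinuousOn X (Icc 0 T)
  initial : X 0 = x₀
  hasDerivAt : ∀ t ∈ Ioo 0 T, HasDerivAt X (u (X t) t) t

/-- Evaluating the velocity at the projection of `x` to `[a, b]` makes it bounded and globally
Lipschitz on `[0, T]`, so Picard-Lindelöf gives a solution on all of `[0, T]` at once. -/
theorem exists_clamped_characteristic {u ux : ℝ → ℝ → ℝ}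
    (hu : Continuous fun p : ℝ × ℝ => u p.1 p.2) (hux : Continuous fun p : ℝ × ℝ => ux p.1 p.2)
    (hder : ∀ x t, HasDerivAt (fun y => u y t) (ux x t) x) {T : ℝ} (hT : 0 < T)
    {a b : ℝ} (hab : a ≤ b) (x₀ : ℝ) :
    ∃ X, IsCharacteristic (fun x t => u (projIcc a b hab x) t) T x₀ X := by
  obtain ⟨K, hK⟩ := (isCompact_Icc (a := a) (b := b)).prod (isCompact_Icc (a := 0) (b := T))
    |>.exists_bound_of_continuousOn hux.continuousOn
  obtain ⟨L, hL⟩ := (isCompact_Icc (a := a) (b := b)).prod (isCompact_Icc (a := 0) (b := T))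
    |>.exists_bound_of_continuousOn hu.continuousOn
  have hK0 : 0 ≤ K := (norm_nonneg _).trans (hK (a, 0) ⟨⟨le_rfl, hab⟩, ⟨le_rfl, hT.le⟩⟩)
  have hL0 : 0 ≤ L := (norm_nonneg _).trans (hL (a, 0) ⟨⟨le_rfl, hab⟩, ⟨le_rfl, hT.le⟩⟩)
  have hLip : ∀ t ∈ Icc 0 T, LipschitzWith ⟨K, hK0⟩ fun x => u (projIcc a b hab x) t := by
    intro t ht
    refine LipschitzWith.of_dist_le_mul fun x y => ?_
    have h1 := (convex_Icc a b).norm_image_sub_le_of_norm_hasDerivWithin_le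
      (f := fun y => u y t) (f' := fun x => ux x t) (C := K)
      (fun z _ => (hder z t).hasDerivWithinAt) (fun z hz => hK (z, t) ⟨hz, ht⟩)
      (projIcc a b hab y).2 (projIcc a b hab x).2
    rw [Real.dist_eq]
    refine h1.trans (mul_le_mul_of_nonneg_left ?_ hK0)
    have h2 := (LipschitzWith.projIcc hab).dist_le_mul x y
    simpa [Subtype.dist_eq, Real.dist_eq] using h2
  have hPL : IsPicardLindelof (fun t x => u (projIcc a b hab x) t)
      (⟨0, le_rfl, hT.le⟩ : Icc (0 : ℝ) T) x₀ ⟨L * T, by positivity⟩ 0 ⟨L, hL0⟩ ⟨K, hK0⟩ := by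
    refine ⟨fun t ht => (hLip t ht).lipschitzOnWith, fun x _ => ?_, fun t ht x _ =>
      hL (_, t) ⟨(projIcc a b hab x).2, ht⟩, ?_⟩
    · exact Continuous.continuousOn
        (hu.comp (f := fun t : ℝ => ((projIcc a b hab x : ℝ), t)) (by fun_prop))
    · simp only [NNReal.coe_zero, sub_zero, sub_self, max_eq_left hT.le]
      exact le_rfl
  obtain ⟨X, hX0, hX⟩ := hPL.exists_eq_forall_mem_Icc_hasDerivWithinAt
    (Metric.mem_closedBall_self le_rfl)
  exact ⟨X, fun t ht => (hX t ht).continuousWithinAt, hX0, fun t ht =>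
    (hX t (Ioo_subset_Icc_self ht)).hasDerivAt (Icc_mem_nhds ht.1 ht.2)⟩

/-- The neutrality integral is `F a - F b`. Its convergence along the product filter makes `F`
Cauchy at `+∞` by comparison with one fixed far-left point, and equates the two limits. -/
theorem exists_common_limit_of_isNeutral {c : ℝ} {ρ₀ F : ℝ → ℝ} (hρ : Continuous ρ₀)
    (h : IsNeutral c ρ₀) (hF : ∀ x, HasDerivAt F (c - ρ₀ x) x) :
    ∃ e, Tendsto F atTop (𝓝 e) ∧ Tendsto F atBot (𝓝 e) := by
  have hint : ∀ a b, ∫ x in a..b, (ρ₀ x - c) = F a - F b := fun a b => by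
    rw [intervalIntegral.integral_eq_sub_of_hasDerivAt (f := fun x => -F x)
      (fun x _ => (hF x).neg.congr_deriv (by ring))
      (Continuous.intervalIntegrable (by fun_prop) _ _)]
    ring
  have key : ∀ ε > 0, ∃ A B, ∀ a ≤ A, ∀ b, B ≤ b → |F a - F b| < ε := fun ε hε => by
    have h1 := (Metric.tendsto_nhds.1 h) ε hε
    rw [eventually_prod_iff] at h1
    obtain ⟨pa, hpa, pb, hpb, hp⟩ := h1
    obtain ⟨A, hA⟩ := eventually_atBot.1 hpa
    obtain ⟨B, hB⟩ := eventually_atTop.1 hpb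
    refine ⟨A, B, fun a ha b hb => ?_⟩
    have := hp (hA a ha) (hB b hb)
    rwa [hint, dist_zero_right] at this
  have hc : CauchySeq F := by
    refine Metric.cauchySeq_iff'.2 fun ε hε => ?_
    obtain ⟨A, B, hAB⟩ := key (ε / 2) (half_pos hε)
    refine ⟨B, fun b hb => ?_⟩
    have h1 := abs_lt.1 (hAB A le_rfl b hb)
    have h2 := abs_lt.1 (hAB A le_rfl B le_rfl)
    rw [Real.dist_eq, abs_lt]
    constructor <;> linarith [h1.1, h1.2, h2.1, h2.2]
  obtain ⟨e, he⟩ := cauchySeq_tendsto_of_complete hc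
  refine ⟨e, he, Metric.tendsto_nhds.2 fun ε hε => ?_⟩
  obtain ⟨A, B, hAB⟩ := key (ε / 2) (half_pos hε)
  obtain ⟨b, hb, hb'⟩ := ((eventually_ge_atTop B).and
    (Metric.tendsto_nhds.1 he (ε / 2) (half_pos hε))).exists
  filter_upwards [eventually_le_atBot A] with a ha
  have h1 := abs_lt.1 (hAB a ha b hb)
  rw [Real.dist_eq] at hb' ⊢
  have h2 := abs_lt.1 hb'
  rw [abs_lt]
  constructor <;> linarith [h1.1, h1.2, h2.1, h2.2]

/-! ### Global characteristics and vanishing of the field drift -/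

namespace IsFlowSolution

variable {ν k c : ℝ} {ρ ρx ρt u ux ut E : ℝ → ℝ → ℝ}

/-- The part of the change of the field along characteristics that depends on time only. -/
noncomputable def fieldDrift (ρ u E : ℝ → ℝ → ℝ) (t : ℝ) : ℝ :=
  E 0 t - E 0 0 - ∫ s in 0..t, ρ 0 s * u 0 s

theorem continuous_fieldDrift (h : IsFlowSolution ν k c ρ ρx ρt u ux ut E) :
    Continuous (fieldDrift ρ u E) := by
  have hρ := h.density.cont
  have hu := h.velocity.cont
  have hE := h.cont_field
  have h1 : Continuous fun s => ρ 0 s * u 0 s := by fun_prop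
  have h2 : Continuous fun t => ∫ s in 0..t, ρ 0 s * u 0 s :=
    intervalIntegral.continuous_primitive (fun a b => h1.intervalIntegrable a b) 0
  unfold fieldDrift
  fun_prop

theorem continuousOn_comp {f : ℝ → ℝ → ℝ} (hf : Continuous fun p : ℝ × ℝ => f p.1 p.2)
    {T x₀ : ℝ} {X : ℝ → ℝ} (hX : IsCharacteristic u T x₀ X) :
    ContinuousOn (fun t => f (X t) t) (Icc 0 T) :=
  hf.comp_continuousOn (f := fun t => (X t, t)) (hX.continuousOn.prodMk continuousOn_id)

/-- Along `X` the field relative to the origin changes at rate `c u - ρ(0,t) u(0,t)`. The second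
term and `E(0,t)` depend on time only and are collected in `fieldDrift`; `E(0,t)` is merely
continuous, so the difference is differentiated, not the field itself. -/
theorem field_along (h : IsFlowSolution ν k c ρ ρx ρt u ux ut E) {T x₀ : ℝ} {X : ℝ → ℝ}
    (hX : IsCharacteristic u T x₀ X) {t : ℝ} (ht : t ∈ Icc 0 T) :
    E (X t) t = E x₀ 0 + c * (X t - x₀) + fieldDrift ρ u E t := by
  have hρ := h.density.cont
  have hu := h.velocity.cont
  have hE := h.cont_field
  have h1 : Continuous fun s => ρ 0 s * u 0 s := by fun_prop
  have h2 : Continuous fun t => ∫ s in 0..t, ρ 0 s * u 0 s :=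
    intervalIntegral.continuous_primitive (fun a b => h1.intervalIntegrable a b) 0
  have hEX := continuousOn_comp h.cont_field hX
  have hE0 : Continuous fun t => E 0 t := by fun_prop
  have := eq_left_of_hasDerivAt_zero
    (f := fun t => E (X t) t - E 0 t + (∫ s in 0..t, ρ 0 s * u 0 s) - c * X t)
    (((hEX.sub hE0.continuousOn).add h2.continuousOn).sub
      (continuousOn_const.mul hX.continuousOn))
    (fun t ht => (((h.hasDerivAt_field_sub hX.hasDerivAt ht).add
      (h1.integral_hasStrictDerivAt 0 t).hasDerivAt).sub
      ((hX.hasDerivAt t ht).const_mul c)).congr_deriv (by ring)) ht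
  simp only [intervalIntegral.integral_same, hX.initial] at this
  unfold fieldDrift
  linarith

theorem hasDerivAt_velocity (h : IsFlowSolution ν k c ρ ρx ρt u ux ut E) {T x₀ : ℝ} {X : ℝ → ℝ}
    (hX : IsCharacteristic u T x₀ X) {t : ℝ} (ht : t ∈ Ioo 0 T) :
    HasDerivAt (fun t => u (X t) t) (-k * E (X t) t - ν * u (X t) t) t :=
  (h.velocity.hasDerivAt_comp ht.1 (hX.hasDerivAt t ht)).congr_deriv
    (by linarith [h.momentum (X t) t])

theorem energy_le (h : IsFlowSolution ν k c ρ ρx ρt u ux ut E) (hν : 0 < ν)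
    (hk : 0 < k) {T x₀ M : ℝ} {X : ℝ → ℝ} (hX : IsCharacteristic u T x₀ X)
    (hM : ∀ t ∈ Ioo 0 T, |E x₀ 0 + fieldDrift ρ u E t| ≤ M) {t : ℝ} (ht : t ∈ Icc 0 T) :
    u (X t) t ^ 2 + k * c * (X t - x₀) ^ 2 ≤ u x₀ 0 ^ 2 + T * ((k * M) ^ 2 / (2 * ν)) := by
  have h1 := oscillator_energy_le (κ := k * c) (M := k * M) hν (z := fun t => X t - x₀)
    (w := fun t => u (X t) t) (f := fun t => -k * (E x₀ 0 + fieldDrift ρ u E t))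
    (hX.continuousOn.sub continuousOn_const) (continuousOn_comp h.velocity.cont hX)
    (fun t ht => (hX.hasDerivAt t ht).sub_const x₀)
    (fun t ht => (h.hasDerivAt_velocity hX ht).congr_deriv (by
      rw [h.field_along hX (Ioo_subset_Icc_self ht)]; ring))
    (fun t ht => by
      rw [abs_mul, abs_neg, abs_of_pos hk]
      exact mul_le_mul_of_nonneg_left (hM t ht) hk.le) ht
  have h2 : t * ((k * M) ^ 2 / (2 * ν)) ≤ T * ((k * M) ^ 2 / (2 * ν)) :=
    mul_le_mul_of_nonneg_right ht.2 (by positivity)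
  simp only [hX.initial, sub_self] at h1
  linarith

/-- A clamped characteristic is genuine until it first moves a distance `R` from `x₀`. Up to then
the energy estimate keeps it within `√(C / (k * c)) < R`, so this never happens. -/
theorem exists_characteristic (h : IsFlowSolution ν k c ρ ρx ρt u ux ut E) (hν : 0 < ν)
    (hk : 0 < k) (hc : 0 < c) {T : ℝ} (hT : 0 < T) (x₀ : ℝ) :
    ∃ X, IsCharacteristic u T x₀ X := by
  obtain ⟨M, hM⟩ := (isCompact_Icc (a := 0) (b := T)).exists_bound_of_continuousOn
    (f := fun t => E x₀ 0 + fieldDrift ρ u E t)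
    (continuous_const.add h.continuous_fieldDrift).continuousOn
  set C := u x₀ 0 ^ 2 + T * ((k * M) ^ 2 / (2 * ν)) with hC
  have hC0 : 0 ≤ C := by positivity
  set R := √(C / (k * c)) + 1 with hR
  have hR0 : 0 < R := by positivity
  have hab : x₀ - R ≤ x₀ + R := by linarith
  obtain ⟨X, hX⟩ := exists_clamped_characteristic h.velocity.cont h.velocity.cont_x
    h.velocity.hasDerivAt_x hT hab x₀
  have hproj : ∀ t, |X t - x₀| < R → (projIcc (x₀ - R) (x₀ + R) hab (X t) : ℝ) = X t := by
    intro t ht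
    rw [abs_lt] at ht
    rw [projIcc_of_mem hab ⟨by linarith [ht.1], by linarith [ht.2]⟩]
  have hstay : ∀ t ∈ Icc 0 T, |X t - x₀| < R := by
    by_contra! hex
    have hXabs : ContinuousOn (fun t => |X t - x₀|) (Icc 0 T) :=
      (hX.continuousOn.sub continuousOn_const).abs
    have hcl : IsClosed (Icc 0 T ∩ (fun t => |X t - x₀|) ⁻¹' Ici R) :=
      hXabs.preimage_isClosed_of_isClosed isClosed_Icc isClosed_Ici
    obtain ⟨t₁, ⟨ht₁, hR₁⟩, hmin⟩ :=
      (isCompact_Icc.of_isClosed_subset hcl inter_subset_left).exists_isLeast hex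
    have hbefore : ∀ t ∈ Ioo 0 t₁, |X t - x₀| < R := fun t ht => by
      by_contra! hge
      exact absurd (hmin ⟨⟨ht.1.le, ht.2.le.trans ht₁.2⟩, hge⟩) (not_le.2 ht.2)
    have hX₁ : IsCharacteristic u t₁ x₀ X :=
      ⟨hX.continuousOn.mono (Icc_subset_Icc_right ht₁.2), hX.initial, fun t ht => by
        have := hX.hasDerivAt t ⟨ht.1, ht.2.trans_le ht₁.2⟩
        rwa [hproj t (hbefore t ht)] at this⟩
    have he := h.energy_le hν hk hX₁
      (fun t ht => hM t ⟨ht.1.le, ht.2.le.trans ht₁.2⟩) ⟨ht₁.1, le_rfl⟩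
    have h2 : t₁ * ((k * M) ^ 2 / (2 * ν)) ≤ T * ((k * M) ^ 2 / (2 * ν)) :=
      mul_le_mul_of_nonneg_right ht₁.2 (by positivity)
    have h3 : (X t₁ - x₀) ^ 2 ≤ C / (k * c) := by
      rw [le_div_iff₀ (mul_pos hk hc)]
      nlinarith [sq_nonneg (u (X t₁) t₁)]
    have h4 := Real.abs_le_sqrt h3
    have h5 : R ≤ |X t₁ - x₀| := hR₁
    linarith
  exact ⟨X, hX.continuousOn, hX.initial, fun t ht => by
    have := hX.hasDerivAt t ht
    rwa [hproj t (hstay t (Ioo_subset_Icc_self ht))] at this⟩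

/-- Far out, displacements `Y = X - x` are uniformly bounded, so the particles stay far out and the
field they feel tends to `0` at each positive time. By `field_along`, `Y(T) → -(e + γ(T)) / c`. On
the other hand, particles starting nearly at rest and feeling a vanishing force satisfy `Y(T) → 0`.
-/
theorem far_field_add_drift_eq_zero (h : IsFlowSolution ν k c ρ ρx ρt u ux ut E) (hν : 0 < ν)
    (hk : 0 < k) (hc : 0 < c) {e : ℝ} (he : Tendsto (fun x => E x 0) atTop (𝓝 e))
    (hu0 : Tendsto (fun x => u x 0) atTop (𝓝 0)) {T : ℝ} (hT : 0 < T) :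
    e + fieldDrift ρ u E T = 0 := by
  set γ := fieldDrift ρ u E with hγ
  have hγc : Continuous γ := h.continuous_fieldDrift
  choose X hX using fun x => h.exists_characteristic hν hk hc hT x
  obtain ⟨G, hG⟩ := (isCompact_Icc (a := 0) (b := T)).exists_bound_of_continuousOn hγc.continuousOn
  set M := |e| + 1 + G with hM
  set C := 1 + T * ((k * M) ^ 2 / (2 * ν)) with hC
  set R := √(C / (k * c)) with hR
  have hEM : ∀ᶠ x in atTop, |E x 0| ≤ |e| + 1 :=
    he.abs.eventually_le_const (by linarith)
  have huM : ∀ᶠ x in atTop, |u x 0| ≤ 1 := hu0.abs.eventually_le_const (by simp)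
  have hbound : ∀ᶠ x in atTop, ∀ t ∈ Icc 0 T, |X x t - x| ≤ R ∧ u (X x t) t ^ 2 ≤ C := by
    filter_upwards [hEM, huM] with x hx1 hx2 t ht
    have h1 := h.energy_le hν hk (hX x) (M := M) (fun t ht => by
      have h2 := hG t (Ioo_subset_Icc_self ht)
      rw [Real.norm_eq_abs] at h2
      have h3 := abs_add_le (E x 0) (γ t)
      linarith) ht
    have h2 : u x 0 ^ 2 ≤ 1 := (sq_le_one_iff_abs_le_one _).2 hx2
    have h3 : 0 ≤ k * c * (X x t - x) ^ 2 := by positivity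
    refine ⟨Real.abs_le_sqrt ?_, by linarith⟩
    rw [le_div_iff₀ (mul_pos hk hc)]
    nlinarith [sq_nonneg (u (X x t) t)]
  have hXtop : ∀ t ∈ Icc 0 T, Tendsto (fun x => X x t) atTop atTop := fun t ht => by
    refine tendsto_atTop_mono' atTop ?_ (tendsto_atTop_add_const_right atTop (-R) tendsto_id)
    filter_upwards [hbound] with x hx
    have := (abs_le.1 (hx t ht).1).1
    simp only [id]
    linarith
  have hEX : ∀ t ∈ Ioc 0 T, Tendsto (fun x => E (X x t) t) atTop (𝓝 0) := fun t ht =>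
    (h.field_atTop t ht.1).comp (hXtop t ⟨ht.1.le, ht.2⟩)
  have hfa : ∀ x, ∀ t ∈ Icc 0 T, E (X x t) t = E x 0 + c * (X x t - x) + γ t := fun x t ht =>
    h.field_along (hX x) ht
  have hY : Tendsto (fun x => X x T - x) atTop (𝓝 (-(e + γ T) / c)) := by
    have h1 := (((hEX T ⟨hT, le_rfl⟩).sub he).sub_const (γ T)).div_const c
    refine (h1.congr fun x => ?_).trans (le_of_eq (by congr 1; ring))
    rw [hfa x T ⟨hT.le, le_rfl⟩]
    field_simp
    ring
  have hEc : ∀ x, ContinuousOn (fun t => E (X x t) t) (Icc 0 T) := fun x =>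
    continuousOn_comp h.cont_field (hX x)
  have huc : ∀ x, ContinuousOn (fun t => u (X x t) t) (Icc 0 T) := fun x =>
    continuousOn_comp h.velocity.cont (hX x)
  -- Integrating `(u + ν Y)' = -k E` in time; dominated convergence then gives `u + ν Y → 0`.
  have hu' : ∀ x t, t ∈ Icc 0 T → u (X x t) t + ν * (X x t - x) =
      u x 0 + -k * ∫ s in 0..t, E (X x s) s := fun x t ht => by
    have hsub : Icc 0 t ⊆ Icc 0 T := Icc_subset_Icc_right ht.2
    have := intervalIntegral.integral_eq_sub_of_hasDerivAt_of_le ht.1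
      (f := fun t => u (X x t) t + ν * (X x t - x)) (f' := fun s => -k * E (X x s) s)
      (((huc x).add (continuousOn_const.mul
        ((hX x).continuousOn.sub continuousOn_const))).mono hsub)
      (fun s hs => ((h.hasDerivAt_velocity (hX x) ⟨hs.1, hs.2.trans_le ht.2⟩).add
        ((((hX x).hasDerivAt s ⟨hs.1, hs.2.trans_le ht.2⟩).sub_const x).const_mul ν)).congr_deriv
          (by ring))
      ((continuousOn_const.mul ((hEc x).mono hsub)).intervalIntegrable_of_Icc ht.1)
    rw [intervalIntegral.integral_const_mul, (hX x).initial] at this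
    linarith
  have hIoc : ∀ t, t ∈ Icc 0 T → uIoc 0 t ⊆ Ioc 0 T := fun t ht => by
    rw [uIoc_of_le ht.1]; exact Ioc_subset_Ioc_right ht.2
  have hEint : ∀ t ∈ Icc 0 T, Tendsto (fun x => ∫ s in 0..t, E (X x s) s) atTop (𝓝 0) := by
    intro t ht
    have := intervalIntegral.tendsto_integral_filter_of_dominated_convergence
      (μ := MeasureTheory.volume) (a := 0) (b := t) (l := (atTop : Filter ℝ))
      (F := fun x s => E (X x s) s) (f := fun _ => 0)
      (fun _ => M + c * R)
      (Eventually.of_forall fun x => ((hEc x).mono ((hIoc t ht).trans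
        Ioc_subset_Icc_self)).aestronglyMeasurable measurableSet_uIoc)
      (by
        filter_upwards [hEM, hbound] with x hx1 hx2
        refine Eventually.of_forall fun s hs => ?_
        have hs' := Ioc_subset_Icc_self (hIoc t ht hs)
        have h1 := hG s hs'
        rw [Real.norm_eq_abs] at h1 ⊢
        rw [hfa x s hs']
        have h2 : |c * (X x s - x)| ≤ c * R := by
          rw [abs_mul, abs_of_pos hc]
          exact mul_le_mul_of_nonneg_left (hx2 s hs').1 hc.le
        have h3 := abs_add_three (E x 0) (c * (X x s - x)) (γ s)
        linarith)
      intervalIntegrable_const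
      (Eventually.of_forall fun s hs => hEX s (hIoc t ht hs))
    simpa using this
  have huY : ∀ t ∈ Icc 0 T, Tendsto (fun x => u (X x t) t + ν * (X x t - x)) atTop (𝓝 0) := by
    intro t ht
    have h1 := hu0.add ((hEint t ht).const_mul (-k))
    rw [mul_zero, add_zero] at h1
    exact h1.congr fun x => (hu' x t ht).symm
  -- The integrating factor `exp (ν s)` recovers `Y` from `Y' + ν Y = u + ν Y`, and a second
  -- dominated convergence gives `Y(T) → 0`.
  have hexp : ∀ x, Real.exp (ν * T) * (X x T - x) =
      ∫ s in 0..T, Real.exp (ν * s) * (u (X x s) s + ν * (X x s - x)) := fun x => by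
    have hid : ∀ s, HasDerivAt (fun s => Real.exp (ν * s)) (Real.exp (ν * s) * ν) s := fun s => by
      simpa using ((hasDerivAt_id s).const_mul ν).exp
    have he : Continuous fun s => Real.exp (ν * s) := by fun_prop
    have hXc := (hX x).continuousOn.sub (continuousOn_const (c := x))
    have := intervalIntegral.integral_eq_sub_of_hasDerivAt_of_le hT.le
      (f := fun t => Real.exp (ν * t) * (X x t - x))
      (f' := fun s => Real.exp (ν * s) * (u (X x s) s + ν * (X x s - x)))
      (he.continuousOn.mul hXc)
      (fun s hs => ((hid s).mul (((hX x).hasDerivAt s hs).sub_const x)).congr_deriv (by ring))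
      ((he.continuousOn.mul ((huc x).add (continuousOn_const.mul hXc))).intervalIntegrable_of_Icc
        hT.le)
    rw [this, (hX x).initial]
    ring
  have hexp0 : Tendsto (fun x => Real.exp (ν * T) * (X x T - x)) atTop (𝓝 0) := by
    simp only [hexp]
    have := intervalIntegral.tendsto_integral_filter_of_dominated_convergence
      (μ := MeasureTheory.volume) (a := 0) (b := T) (l := (atTop : Filter ℝ))
      (F := fun x s => Real.exp (ν * s) * (u (X x s) s + ν * (X x s - x))) (f := fun _ => 0)
      (fun _ => Real.exp (ν * T) * (√C + ν * R))
      (Eventually.of_forall fun x => ContinuousOn.aestronglyMeasurable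
        ((Continuous.continuousOn (by fun_prop)).mul
          (((huc x).add (continuousOn_const.mul ((hX x).continuousOn.sub
            continuousOn_const))).mono ((hIoc T ⟨hT.le, le_rfl⟩).trans Ioc_subset_Icc_self)))
              measurableSet_uIoc)
      (by
        filter_upwards [hbound] with x hx
        refine Eventually.of_forall fun s hs => ?_
        have hs' := Ioc_subset_Icc_self (hIoc T ⟨hT.le, le_rfl⟩ hs)
        rw [norm_mul, Real.norm_eq_abs, Real.norm_eq_abs, Real.abs_exp]
        have h1 : Real.exp (ν * s) ≤ Real.exp (ν * T) :=
          Real.exp_le_exp.2 (mul_le_mul_of_nonneg_left hs'.2 hν.le)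
        have h2 := Real.abs_le_sqrt (hx s hs').2
        have h3 : |ν * (X x s - x)| ≤ ν * R := by
          rw [abs_mul, abs_of_pos hν]
          exact mul_le_mul_of_nonneg_left (hx s hs').1 hν.le
        have h4 := abs_add_le (u (X x s) s) (ν * (X x s - x))
        exact mul_le_mul h1 (by linarith) (abs_nonneg _) (Real.exp_pos _).le)
      intervalIntegrable_const
      (Eventually.of_forall fun s hs => by
        have := (huY s (Ioc_subset_Icc_self (hIoc T ⟨hT.le, le_rfl⟩ hs))).const_mul
          (Real.exp (ν * s))
        rwa [mul_zero] at this)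
    simpa using this
  have h1 := tendsto_nhds_unique hexp0 (hY.const_mul (Real.exp (ν * T)))
  have h2 := (mul_eq_zero.1 h1.symm).resolve_left (Real.exp_pos _).ne'
  rcases div_eq_zero_iff.1 h2 with h3 | h3
  · linarith
  · exact absurd h3 hc.ne'

/-- The drift vanishes at `t = 0`, so continuity of `e + γ` there separates the two terms. -/
theorem far_field_eq_zero (h : IsFlowSolution ν k c ρ ρx ρt u ux ut E) (hν : 0 < ν)
    (hk : 0 < k) (hc : 0 < c) {e : ℝ} (he : Tendsto (fun x => E x 0) atTop (𝓝 e))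
    (hu0 : Tendsto (fun x => u x 0) atTop (𝓝 0)) :
    e = 0 ∧ ∀ t, 0 ≤ t → fieldDrift ρ u E t = 0 := by
  have h0 : fieldDrift ρ u E 0 = 0 := by simp [fieldDrift]
  have h1 : EqOn (fun t => e + fieldDrift ρ u E t) (fun _ => 0) (Ioi 0) := fun t ht =>
    h.far_field_add_drift_eq_zero hν hk hc he hu0 ht
  have h2 := h1.closure (continuous_const.add h.continuous_fieldDrift) continuous_const
  rw [closure_Ioi] at h2
  have he0 : e = 0 := by
    have := h2 (mem_Ici.2 le_rfl)
    simpa [h0] using this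
  refine ⟨he0, fun t ht => ?_⟩
  have := h2 (mem_Ici.2 ht)
  simpa [he0] using this

end IsFlowSolution

/-! ### The explicit Lagrangian flow and the initial field -/

/-- Position at time `t` of the particle that starts at `x`, for initial velocity `u₀` and initial
field `E₀`. -/
noncomputable def flowMap (ν c : ℝ) (A A' u₀ E₀ : ℝ → ℝ) (t x : ℝ) : ℝ :=
  x + (A t * u₀ x + (A' t + ν * A t - 1) / c * E₀ x)

/-- Velocity at time `t` of the particle that starts at `x`. -/
def flowVelocity (k : ℝ) (A A' u₀ E₀ : ℝ → ℝ) (t x : ℝ) : ℝ :=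
  A' t * u₀ x - k * A t * E₀ x

/-- Expansion rate `∂X/∂x` of the flow. -/
noncomputable def flowJacobian (ν c : ℝ) (A A' ρ₀ u₀ : ℝ → ℝ) (t x : ℝ) : ℝ :=
  1 + (A t * deriv u₀ x + (A' t + ν * A t - 1) / c * (c - ρ₀ x))

variable {ν k c : ℝ} {A A' ρ₀ u₀ E₀ : ℝ → ℝ}

theorem hasDerivAt_flowMap_space (hu : Differentiable ℝ u₀)
    (hE : ∀ x, HasDerivAt E₀ (c - ρ₀ x) x) (t x : ℝ) :
    HasDerivAt (flowMap ν c A A' u₀ E₀ t) (flowJacobian ν c A A' ρ₀ u₀ t x) x :=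
  (hasDerivAt_id x).add (((hu x).hasDerivAt.const_mul (A t)).add ((hE x).const_mul _))

theorem hasDerivAt_flowVelocity_space (hu : Differentiable ℝ u₀)
    (hE : ∀ x, HasDerivAt E₀ (c - ρ₀ x) x) (t x : ℝ) :
    HasDerivAt (flowVelocity k A A' u₀ E₀ t)
      (A' t * deriv u₀ x - k * A t * (c - ρ₀ x)) x :=
  ((hu x).hasDerivAt.const_mul (A' t)).sub ((hE x).const_mul _)

theorem IsImpulseResponse.hasDerivAt_flowMap (h : IsImpulseResponse ν (k * c) A A') (hc : c ≠ 0)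
    (x t : ℝ) : HasDerivAt (fun t => flowMap ν c A A' u₀ E₀ t x)
      (flowVelocity k A A' u₀ E₀ t x) t :=
  ((((h.hasDerivAt t).mul_const (u₀ x)).add
    ((((h.hasDerivAt_step t).sub_const 1).div_const c).mul_const (E₀ x))).const_add x).congr_deriv
      (by unfold flowVelocity; field_simp; ring)

theorem IsImpulseResponse.hasDerivAt_flowVelocity (h : IsImpulseResponse ν (k * c) A A')
    (hc : c ≠ 0) (x t : ℝ) : HasDerivAt (fun t => flowVelocity k A A' u₀ E₀ t x)
      (-k * (E₀ x + c * (flowMap ν c A A' u₀ E₀ t x - x))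
        - ν * flowVelocity k A A' u₀ E₀ t x) t :=
  (((h.hasDerivAt' t).mul_const (u₀ x)).sub
    (((h.hasDerivAt t).const_mul k).mul_const (E₀ x))).congr_deriv
      (by unfold flowVelocity flowMap; field_simp; ring)

theorem IsImpulseResponse.hasDerivAt_flowJacobian (h : IsImpulseResponse ν (k * c) A A')
    (hc : c ≠ 0) (x t : ℝ) : HasDerivAt (fun t => flowJacobian ν c A A' ρ₀ u₀ t x)
      (A' t * deriv u₀ x - k * A t * (c - ρ₀ x)) t :=
  ((((h.hasDerivAt t).mul_const (deriv u₀ x)).add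
    ((((h.hasDerivAt_step t).sub_const 1).div_const c).mul_const (c - ρ₀ x))).const_add 1).congr_deriv
      (by field_simp; ring)

theorem IsImpulseResponse.flowMap_zero (h : IsImpulseResponse ν (k * c) A A') (x : ℝ) :
    flowMap ν c A A' u₀ E₀ 0 x = x := by
  simp [flowMap, h.zero, h.one]

theorem IsImpulseResponse.flowJacobian_zero (h : IsImpulseResponse ν (k * c) A A') (x : ℝ) :
    flowJacobian ν c A A' ρ₀ u₀ 0 x = 1 := by
  simp [flowJacobian, h.zero, h.one]

theorem tendsto_flowMap_atTop (hu : Tendsto u₀ atTop (𝓝 0)) (hE : Tendsto E₀ atTop (𝓝 0)) (t : ℝ) :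
    Tendsto (flowMap ν c A A' u₀ E₀ t) atTop atTop :=
  tendsto_id.atTop_add ((hu.const_mul (A t)).add (hE.const_mul _))

theorem tendsto_flowMap_atBot (hu : Tendsto u₀ atBot (𝓝 0)) (hE : Tendsto E₀ atBot (𝓝 0)) (t : ℝ) :
    Tendsto (flowMap ν c A A' u₀ E₀ t) atBot atBot :=
  tendsto_id.atBot_add ((hu.const_mul (A t)).add (hE.const_mul _))

/-- The initial field determined by neutral initial data. -/
structure IsInitialField (c : ℝ) (ρ₀ E₀ : ℝ → ℝ) : Prop where
  hasDerivAt : ∀ x, HasDerivAt E₀ (c - ρ₀ x) x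
  tendsto_atTop : Tendsto E₀ atTop (𝓝 0)
  tendsto_atBot : Tendsto E₀ atBot (𝓝 0)

theorem IsInitialField.unique {E₁ : ℝ → ℝ} (h : IsInitialField c ρ₀ E₀)
    (h' : IsInitialField c ρ₀ E₁) : E₀ = E₁ := by
  have hd : ∀ x, HasDerivAt (fun x => E₀ x - E₁ x) 0 x := fun x =>
    ((h.hasDerivAt x).sub (h'.hasDerivAt x)).congr_deriv (by ring)
  have hconst : ∀ x y, E₀ x - E₁ x = E₀ y - E₁ y :=
    is_const_of_deriv_eq_zero (fun x => (hd x).differentiableAt) fun x => (hd x).deriv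
  funext x
  have h1 : Tendsto (fun y => E₀ y - E₁ y) atTop (𝓝 (0 - 0)) := h.tendsto_atTop.sub h'.tendsto_atTop
  have h2 := tendsto_nhds_unique (h1.congr fun y => hconst y x) tendsto_const_nhds
  linarith

theorem IsInitialField.contDiff (hE : IsInitialField c ρ₀ E₀) (hρ : Continuous ρ₀) :
    ContDiff ℝ 1 E₀ := by
  rw [contDiff_one_iff_deriv]
  refine ⟨fun x => (hE.hasDerivAt x).differentiableAt, ?_⟩
  rw [funext fun x => (hE.hasDerivAt x).deriv]
  exact continuous_const.sub hρ

theorem IsInitialData.exists_isInitialField (h : IsInitialData c ρ₀ u₀) :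
    ∃ E₀, IsInitialField c ρ₀ E₀ := by
  have hρ := h.density_contDiff.continuous
  have hd : ∀ x, HasDerivAt (fun x => ∫ y in 0..x, (c - ρ₀ y)) (c - ρ₀ x) x := fun x =>
    ((show Continuous fun y => c - ρ₀ y by fun_prop).integral_hasStrictDerivAt 0 x).hasDerivAt
  obtain ⟨e, he, he'⟩ := exists_common_limit_of_isNeutral hρ h.neutral hd
  exact ⟨fun x => (∫ y in 0..x, (c - ρ₀ y)) - e, fun x => (hd x).sub_const e,
    by simpa using he.sub_const e, by simpa using he'.sub_const e⟩

theorem surjective_flowMap (hu : Continuous u₀) (hu1 : Tendsto u₀ atTop (𝓝 0))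
    (hu2 : Tendsto u₀ atBot (𝓝 0)) (hE : IsInitialField c ρ₀ E₀) (t : ℝ) :
    Function.Surjective (flowMap ν c A A' u₀ E₀ t) := by
  have hEc : Continuous E₀ := continuous_iff_continuousAt.2 fun x => (hE.hasDerivAt x).continuousAt
  refine Continuous.surjective ?_ (tendsto_flowMap_atTop hu1 hE.tendsto_atTop t)
    (tendsto_flowMap_atBot hu2 hE.tendsto_atBot t)
  unfold flowMap
  fun_prop

/-! ### Every solution is transported by the explicit flow -/

namespace IsFlowSolution

variable {ρ ρx ρt u ux ut E : ℝ → ℝ → ℝ}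

theorem isInitialField (h : IsFlowSolution ν k c ρ ρx ρt u ux ut E) (hν : 0 < ν) (hk : 0 < k)
    (hc : 0 < c) (hd : IsInitialData c ρ₀ u₀) (hρ0 : ∀ x, ρ x 0 = ρ₀ x)
    (hu0 : ∀ x, u x 0 = u₀ x) :
    IsInitialField c ρ₀ (fun x => E x 0) ∧ ∀ t, 0 ≤ t → fieldDrift ρ u E t = 0 := by
  have hE : ∀ x, HasDerivAt (fun y => E y 0) (c - ρ₀ x) x := fun x => by
    rw [← hρ0]; exact h.hasDerivAt_field_initial x
  obtain ⟨e, he, he'⟩ := exists_common_limit_of_isNeutral hd.density_contDiff.continuous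
    hd.neutral hE
  obtain ⟨rfl, hγ⟩ := h.far_field_eq_zero hν hk hc he
    (by simp only [hu0]; exact hd.velocity_atTop)
  exact ⟨⟨hE, he, he'⟩, hγ⟩

theorem along_flowMap (h : IsFlowSolution ν k c ρ ρx ρt u ux ut E) (hν : 0 < ν) (hk : 0 < k)
    (hc : 0 < c) (hA : IsImpulseResponse ν (k * c) A A') (hd : IsInitialData c ρ₀ u₀)
    (hE₀ : IsInitialField c ρ₀ E₀) (hρ0 : ∀ x, ρ x 0 = ρ₀ x) (hu0 : ∀ x, u x 0 = u₀ x)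
    (x : ℝ) {t : ℝ} (ht : 0 ≤ t) :
    u (flowMap ν c A A' u₀ E₀ t x) t = flowVelocity k A A' u₀ E₀ t x := by
  obtain ⟨hE, hγ⟩ := h.isInitialField hν hk hc hd hρ0 hu0
  obtain rfl := hE₀.unique hE
  -- The horizon `t + 1` is positive even when `t = 0`.
  obtain ⟨X, hX⟩ := h.exists_characteristic hν hk hc (show 0 < t + 1 by linarith) x
  have hYU := hA.eq_of_forced (e := E x 0) hν hk hc (Y := fun t => X t - x)
    (U := fun t => u (X t) t) (hX.continuousOn.sub continuousOn_const)
    (continuousOn_comp h.velocity.cont hX) (fun t ht => (hX.hasDerivAt t ht).sub_const x)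
    (fun t ht => (h.hasDerivAt_velocity hX ht).congr_deriv (by
      rw [h.field_along hX (Ioo_subset_Icc_self ht), hγ t ht.1.le]; ring))
    (by simp [hX.initial]) (t := t) ⟨ht, by linarith⟩
  simp only [hX.initial, hu0] at hYU
  have h1 : X t = flowMap ν c A A' u₀ (fun x => E x 0) t x := by
    unfold flowMap; linarith [hYU.1]
  rw [← h1, hYU.2]
  rfl

/-- Differentiating `u(X) = X_t` in `x` gives `Γ_t = u_x(X) Γ`, which cancels the dilution rate in
the mass equation; so `ρ(X) Γ` is constant in time. No second derivatives of the data enter. -/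
theorem density_along_flowMap (h : IsFlowSolution ν k c ρ ρx ρt u ux ut E) (hν : 0 < ν)
    (hk : 0 < k) (hc : 0 < c) (hA : IsImpulseResponse ν (k * c) A A')
    (hd : IsInitialData c ρ₀ u₀) (hE₀ : IsInitialField c ρ₀ E₀) (hρ0 : ∀ x, ρ x 0 = ρ₀ x)
    (hu0 : ∀ x, u x 0 = u₀ x) (x : ℝ) {t : ℝ} (ht : 0 ≤ t) :
    ρ (flowMap ν c A A' u₀ E₀ t x) t * flowJacobian ν c A A' ρ₀ u₀ t x = ρ₀ x := by
  have hu₀ := hd.velocity_contDiff.differentiable one_ne_zero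
  have hflow : ∀ s, 0 ≤ s → ∀ x, u (flowMap ν c A A' u₀ E₀ s x) s =
      flowVelocity k A A' u₀ E₀ s x := fun s hs x =>
    h.along_flowMap hν hk hc hA hd hE₀ hρ0 hu0 x hs
  have hmap : ∀ s, HasDerivAt (fun s => flowMap ν c A A' u₀ E₀ s x)
      (flowVelocity k A A' u₀ E₀ s x) s := fun s => hA.hasDerivAt_flowMap hc.ne' x s
  have hrate : ∀ s, 0 ≤ s → ux (flowMap ν c A A' u₀ E₀ s x) s * flowJacobian ν c A A' ρ₀ u₀ s x =
      A' s * deriv u₀ x - k * A s * (c - ρ₀ x) := fun s hs => by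
    have h1 : HasDerivAt (fun x => u (flowMap ν c A A' u₀ E₀ s x) s) _ x :=
      HasDerivAt.comp (h₂ := fun y => u y s) x (h.velocity.hasDerivAt_x _ s)
        (hasDerivAt_flowMap_space hu₀ hE₀.hasDerivAt s x)
    have h2 := hasDerivAt_flowVelocity_space (k := k) (A := A) (A' := A') hu₀ hE₀.hasDerivAt s x
    rw [funext (hflow s hs)] at h1
    exact h1.unique h2
  have hmapc : Continuous fun s => flowMap ν c A A' u₀ E₀ s x :=
    continuous_iff_continuousAt.2 fun s => (hmap s).continuousAt
  have hjac := fun s => hA.hasDerivAt_flowJacobian (ρ₀ := ρ₀) (u₀ := u₀) hc.ne' x s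
  have hjacc : Continuous fun s => flowJacobian ν c A A' ρ₀ u₀ s x :=
    continuous_iff_continuousAt.2 fun s => (hjac s).continuousAt
  have hcont : Continuous fun s => ρ (flowMap ν c A A' u₀ E₀ s x) s *
      flowJacobian ν c A A' ρ₀ u₀ s x :=
    (h.density.cont.comp (f := fun s => (flowMap ν c A A' u₀ E₀ s x, s))
      (hmapc.prodMk continuous_id)).mul hjacc
  have := eq_left_of_hasDerivAt_zero (T := t + 1) hcont.continuousOn (fun s hs => by
    refine ((h.density.hasDerivAt_comp hs.1 (hmap s)).mul (hjac s)).congr_deriv ?_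
    have h1 := h.mass (flowMap ν c A A' u₀ E₀ s x) s hs.1
    rw [hflow s hs.1.le x] at h1
    rw [← hrate s hs.1.le]
    linear_combination flowJacobian ν c A A' ρ₀ u₀ s x * h1)
    (t := t) ⟨ht, by linarith⟩
  simpa only [hA.flowMap_zero, hA.flowJacobian_zero, mul_one, hρ0] using this

end IsFlowSolution

namespace IsGlobalSolution

variable {ρ u : ℝ → ℝ → ℝ}

theorem along_flowMap (h : IsGlobalSolution ν k c ρ₀ u₀ ρ u) (hν : 0 < ν) (hk : 0 < k)
    (hc : 0 < c) (hA : IsImpulseResponse ν (k * c) A A') (hd : IsInitialData c ρ₀ u₀)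
    (hE₀ : IsInitialField c ρ₀ E₀) (x : ℝ) {t : ℝ} (ht : 0 ≤ t) :
    u (flowMap ν c A A' u₀ E₀ t x) t = flowVelocity k A A' u₀ E₀ t x ∧
    ρ (flowMap ν c A A' u₀ E₀ t x) t * flowJacobian ν c A A' ρ₀ u₀ t x = ρ₀ x := by
  obtain ⟨ρx, ρt, ux, ut, E, hs⟩ := h.exists_isFlowSolution hk
  have hρ0 : ∀ x, ρ x (max 0 0) = ρ₀ x := fun x => by rw [max_self, h.density_initial]
  have hu0 : ∀ x, u x (max 0 0) = u₀ x := fun x => by rw [max_self, h.velocity_initial]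
  have h1 := hs.along_flowMap hν hk hc hA hd hE₀ hρ0 hu0 x ht
  have h2 := hs.density_along_flowMap hν hk hc hA hd hE₀ hρ0 hu0 x ht
  rw [max_eq_left ht] at h1 h2
  exact ⟨h1, h2⟩

/-- The product `ρ(X) Γ = ρ₀` is never zero, so `Γ` cannot cross zero on its way from `1`.
Positivity of `ρ` at later times is not assumed. -/
theorem flowJacobian_pos (h : IsGlobalSolution ν k c ρ₀ u₀ ρ u) (hν : 0 < ν) (hk : 0 < k)
    (hc : 0 < c) (hA : IsImpulseResponse ν (k * c) A A') (hd : IsInitialData c ρ₀ u₀)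
    (x : ℝ) {t : ℝ} (ht : 0 ≤ t) : 0 < flowJacobian ν c A A' ρ₀ u₀ t x := by
  obtain ⟨E₀, hE₀⟩ := hd.exists_isInitialField
  have hjacc : Continuous fun s => flowJacobian ν c A A' ρ₀ u₀ s x :=
    continuous_iff_continuousAt.2 fun s => (hA.hasDerivAt_flowJacobian hc.ne' x s).continuousAt
  by_contra! hneg
  obtain ⟨s, hs, hs0⟩ := intermediate_value_Icc' ht hjacc.continuousOn
    ⟨hneg, by rw [hA.flowJacobian_zero]; exact zero_le_one⟩
  have h1 := (h.along_flowMap hν hk hc hA hd hE₀ x hs.1).2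
  simp only at hs0
  rw [hs0, mul_zero] at h1
  exact (hd.density_pos x).ne h1

/-- At a fixed time with `A t ≠ 0`, the relation `Γ = ρ₀ / ρ(X)` is solved for `u₀'`. Everything
else in it is `C¹`, so `u₀'` is too: the second derivative is forced by `ρ` being `C¹` at a later
time. -/
theorem contDiff_two_velocity (h : IsGlobalSolution ν k c ρ₀ u₀ ρ u) (hν : 0 < ν) (hk : 0 < k)
    (hc : 0 < c) (hA : IsImpulseResponse ν (k * c) A A') (hd : IsInitialData c ρ₀ u₀) :
    ContDiff ℝ 2 u₀ := by
  obtain ⟨E₀, hE₀⟩ := hd.exists_isInitialField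
  obtain ⟨t, ht, hAt⟩ := hA.exists_ne_zero
  have hu₀ := hd.velocity_contDiff.differentiable one_ne_zero
  have hEc := hE₀.contDiff hd.density_contDiff.continuous
  have hmap : ContDiff ℝ 1 (flowMap ν c A A' u₀ E₀ t) :=
    contDiff_id.add ((contDiff_const.mul hd.velocity_contDiff).add (contDiff_const.mul hEc))
  have hρ : ContDiff ℝ 1 fun x => ρ (flowMap ν c A A' u₀ E₀ t x) t := by
    rw [← contDiffOn_univ]
    exact h.density_contDiffOn.comp (f := fun x => (flowMap ν c A A' u₀ E₀ t x, t))
      (hmap.prodMk contDiff_const).contDiffOn fun x _ => ⟨mem_univ _, ht.le⟩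
  have hprod := fun x => (h.along_flowMap hν hk hc hA hd hE₀ x ht.le).2
  have hρne : ∀ x, ρ (flowMap ν c A A' u₀ E₀ t x) t ≠ 0 := fun x h0 => by
    have := hprod x
    rw [h0, zero_mul] at this
    exact (hd.density_pos x).ne this
  have hderiv : deriv u₀ = fun x => (ρ₀ x / ρ (flowMap ν c A A' u₀ E₀ t x) t - 1
      - (A' t + ν * A t - 1) / c * (c - ρ₀ x)) / A t := by
    funext x
    have h1 : flowJacobian ν c A A' ρ₀ u₀ t x = ρ₀ x / ρ (flowMap ν c A A' u₀ E₀ t x) t := by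
      rw [eq_div_iff (hρne x), mul_comm]
      exact hprod x
    rw [eq_div_iff hAt, ← h1]
    unfold flowJacobian
    ring
  rw [show (2 : WithTop ℕ∞) = 1 + 1 by norm_num, contDiff_succ_iff_deriv]
  refine ⟨hu₀, by simp, ?_⟩
  rw [hderiv]
  exact (((hd.density_contDiff.div hρ hρne).sub contDiff_const).sub
    (contDiff_const.mul (contDiff_const.sub hd.density_contDiff))).div_const _

theorem unique {ρ' u' : ℝ → ℝ → ℝ} (h : IsGlobalSolution ν k c ρ₀ u₀ ρ u)
    (h' : IsGlobalSolution ν k c ρ₀ u₀ ρ' u') (hν : 0 < ν) (hk : 0 < k)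
    (hc : 0 < c) (hA : IsImpulseResponse ν (k * c) A A') (hd : IsInitialData c ρ₀ u₀)
    (x : ℝ) {t : ℝ} (ht : 0 ≤ t) : ρ x t = ρ' x t ∧ u x t = u' x t := by
  obtain ⟨E₀, hE₀⟩ := hd.exists_isInitialField
  obtain ⟨y, rfl⟩ := surjective_flowMap (ν := ν) (A := A) (A' := A')
    hd.velocity_contDiff.continuous hd.velocity_atTop hd.velocity_atBot hE₀ t x
  obtain ⟨h1, h2⟩ := h.along_flowMap hν hk hc hA hd hE₀ y ht
  obtain ⟨h1', h2'⟩ := h'.along_flowMap hν hk hc hA hd hE₀ y ht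
  exact ⟨mul_right_cancel₀ (h.flowJacobian_pos hν hk hc hA hd y ht).ne' (h2.trans h2'.symm),
    h1.trans h1'.symm⟩

end IsGlobalSolution

/-! ### Construction of a solution by inverting the flow -/

theorem hasDerivAt_comp_of_contDiffOn {f : ℝ → ℝ → ℝ}
    (hf : ContDiffOn ℝ 1 (fun p : ℝ × ℝ => f p.1 p.2) (univ ×ˢ Ici 0)) {X : ℝ → ℝ} {X' t : ℝ}
    (ht : 0 < t) (hX : HasDerivAt X X' t) :
    HasDerivAt (fun s => f (X s) s)
      (deriv (fun y => f y t) (X t) * X' + deriv (fun s => f (X t) s) t) t := by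
  have hn : (univ ×ˢ Ici 0 : Set (ℝ × ℝ)) ∈ 𝓝 (X t, t) := prod_mem_nhds univ_mem (Ici_mem_nhds ht)
  have hF := ((hf.contDiffAt hn).differentiableAt one_ne_zero).hasFDerivAt
  set F' := fderiv ℝ (fun p : ℝ × ℝ => f p.1 p.2) (X t, t)
  have hx : HasDerivAt (fun y => f y t) (F' (1, 0)) (X t) :=
    HasFDerivAt.comp_hasDerivAt (f := fun y => (y, t)) (X t) hF
      ((hasDerivAt_id (X t)).prodMk (hasDerivAt_const (X t) t))
  have ht' : HasDerivAt (fun s => f (X t) s) (F' (0, 1)) t :=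
    HasFDerivAt.comp_hasDerivAt (f := fun s => (X t, s)) t hF
      ((hasDerivAt_const t (X t)).prodMk (hasDerivAt_id t))
  have hXs : HasDerivAt (fun s => f (X s) s) (F' (X', 1)) t :=
    HasFDerivAt.comp_hasDerivAt (f := fun s => (X s, s)) t hF (hX.prodMk (hasDerivAt_id t))
  refine hXs.congr_deriv ?_
  rw [hx.deriv, ht'.deriv, show ((X', 1) : ℝ × ℝ) = X' • (1, 0) + (0, 1) by simp, map_add, map_smul,
    smul_eq_mul, mul_comm]

/-- The shear `(a, b) ↦ (g a + v b, b)`. -/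
noncomputable def shearEquiv (g v : ℝ) (hg : g ≠ 0) : (ℝ × ℝ) ≃L[ℝ] ℝ × ℝ :=
  ContinuousLinearEquiv.equivOfInverse
    ((g • ContinuousLinearMap.fst ℝ ℝ ℝ + v • ContinuousLinearMap.snd ℝ ℝ ℝ).prod
      (ContinuousLinearMap.snd ℝ ℝ ℝ))
    ((g⁻¹ • (ContinuousLinearMap.fst ℝ ℝ ℝ - v • ContinuousLinearMap.snd ℝ ℝ ℝ)).prod
      (ContinuousLinearMap.snd ℝ ℝ ℝ))
    (fun p => by ext <;> simp; field_simp)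
    (fun p => by ext <;> simp; field_simp; ring)

theorem contDiff_flowMap (hA : IsImpulseResponse ν (k * c) A A') (hu : ContDiff ℝ 1 u₀)
    (hE : ContDiff ℝ 1 E₀) :
    ContDiff ℝ 1 fun p : ℝ × ℝ => flowMap ν c A A' u₀ E₀ p.2 p.1 := by
  have h1 := hA.contDiff_one.comp (contDiff_snd (E := ℝ) (F := ℝ))
  have h2 := hA.contDiff_one'.comp (contDiff_snd (E := ℝ) (F := ℝ))
  have h3 := hu.comp (contDiff_fst (E := ℝ) (F := ℝ))
  have h4 := hE.comp (contDiff_fst (E := ℝ) (F := ℝ))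
  exact contDiff_fst.add ((h1.mul h3).add ((((h2.add (contDiff_const.mul h1)).sub
    contDiff_const).div_const c).mul h4))

theorem contDiff_flowVelocity (hA : IsImpulseResponse ν (k * c) A A') (hu : ContDiff ℝ 1 u₀)
    (hE : ContDiff ℝ 1 E₀) :
    ContDiff ℝ 1 fun p : ℝ × ℝ => flowVelocity k A A' u₀ E₀ p.2 p.1 := by
  have h1 := hA.contDiff_one.comp (contDiff_snd (E := ℝ) (F := ℝ))
  have h2 := hA.contDiff_one'.comp (contDiff_snd (E := ℝ) (F := ℝ))
  have h3 := hu.comp (contDiff_fst (E := ℝ) (F := ℝ))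
  have h4 := hE.comp (contDiff_fst (E := ℝ) (F := ℝ))
  exact (h2.mul h3).sub ((contDiff_const.mul h1).mul h4)

theorem contDiff_flowJacobian (hA : IsImpulseResponse ν (k * c) A A')
    (hu : ContDiff ℝ 1 (deriv u₀)) (hρ : ContDiff ℝ 1 ρ₀) :
    ContDiff ℝ 1 fun p : ℝ × ℝ => flowJacobian ν c A A' ρ₀ u₀ p.2 p.1 := by
  have h1 := hA.contDiff_one.comp (contDiff_snd (E := ℝ) (F := ℝ))
  have h2 := hA.contDiff_one'.comp (contDiff_snd (E := ℝ) (F := ℝ))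
  have h3 := hu.comp (contDiff_fst (E := ℝ) (F := ℝ))
  have h4 := hρ.comp (contDiff_fst (E := ℝ) (F := ℝ))
  exact contDiff_const.add ((h1.mul h3).add ((((h2.add (contDiff_const.mul h1)).sub
    contDiff_const).div_const c).mul (contDiff_const.sub h4)))

theorem hasFDerivAt_flowMap (hA : IsImpulseResponse ν (k * c) A A') (hc : c ≠ 0)
    (hu : ContDiff ℝ 1 u₀) (hE : IsInitialField c ρ₀ E₀) (hρ : Continuous ρ₀) {x t : ℝ}
    (hg : flowJacobian ν c A A' ρ₀ u₀ t x ≠ 0) :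
    HasFDerivAt (fun p : ℝ × ℝ => (flowMap ν c A A' u₀ E₀ p.2 p.1, p.2))
      (shearEquiv (flowJacobian ν c A A' ρ₀ u₀ t x) (flowVelocity k A A' u₀ E₀ t x) hg :
        ℝ × ℝ →L[ℝ] ℝ × ℝ) (x, t) := by
  have hF := ((contDiff_flowMap hA hu (hE.contDiff hρ)).contDiffAt (x := (x, t))).differentiableAt
    one_ne_zero |>.hasFDerivAt
  set F' := fderiv ℝ (fun p : ℝ × ℝ => flowMap ν c A A' u₀ E₀ p.2 p.1) (x, t)
  have hx : HasDerivAt (flowMap ν c A A' u₀ E₀ t) (F' (1, 0)) x :=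
    HasFDerivAt.comp_hasDerivAt (f := fun y => (y, t)) x hF
      ((hasDerivAt_id x).prodMk (hasDerivAt_const x t))
  have ht : HasDerivAt (fun s => flowMap ν c A A' u₀ E₀ s x) (F' (0, 1)) t :=
    HasFDerivAt.comp_hasDerivAt (f := fun s => (x, s)) t hF
      ((hasDerivAt_const t x).prodMk (hasDerivAt_id t))
  have h1 := hx.unique
    (hasDerivAt_flowMap_space (hu.differentiable one_ne_zero) hE.hasDerivAt t x)
  have h2 := ht.unique (hA.hasDerivAt_flowMap hc x t)
  refine (hF.prodMk hasFDerivAt_snd).congr_fderiv ?_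
  ext <;> simp [shearEquiv, h1, h2]

section inverse

variable {Ψ : ℝ → ℝ → ℝ}

/-- A right inverse of the flow map is `C¹` up to the initial time when the Jacobian is
positive. -/
theorem contDiffOn_flowMap_inverse (hA : IsImpulseResponse ν (k * c) A A') (hc : c ≠ 0)
    (hu : ContDiff ℝ 1 u₀) (hE : IsInitialField c ρ₀ E₀) (hρ : Continuous ρ₀)
    (hpos : ∀ x t, 0 ≤ t → 0 < flowJacobian ν c A A' ρ₀ u₀ t x)
    (hr : ∀ y t, flowMap ν c A A' u₀ E₀ t (Ψ y t) = y)
    (hl : ∀ x t, 0 ≤ t → Ψ (flowMap ν c A A' u₀ E₀ t x) t = x) :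
    ContDiffOn ℝ 1 (fun p : ℝ × ℝ => Ψ p.1 p.2) (univ ×ˢ Ici 0) := by
  rintro ⟨y, t⟩ ⟨-, ht⟩
  set x := Ψ y t with hx
  set Φ : ℝ × ℝ → ℝ × ℝ := fun p => (flowMap ν c A A' u₀ E₀ p.2 p.1, p.2) with hΦ
  have hΦC : ContDiffAt ℝ 1 Φ (x, t) :=
    ((contDiff_flowMap hA hu (hE.contDiff hρ)).prodMk contDiff_snd).contDiffAt
  have hΦ' := hasFDerivAt_flowMap hA hc hu hE hρ (hpos x t ht).ne'
  have hΦx : Φ (x, t) = (y, t) := by simp only [hΦ, hx, hr]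
  -- The explicit flow is defined for negative times as well, so the inverse function theorem
  -- applies also at `t = 0`; the local inverse is compared with `Ψ` only for `t ≥ 0`.
  have hL := hΦC.to_localInverse hΦ' one_ne_zero
  have hev := (hΦC.hasStrictFDerivAt' hΦ' one_ne_zero).eventually_right_inverse
  rw [hΦx] at hL hev
  have heq : (fun p : ℝ × ℝ => Ψ p.1 p.2) =ᶠ[𝓝[univ ×ˢ Ici 0] (y, t)]
      fun p => (hΦC.localInverse hΦ' one_ne_zero p).1 := by
    filter_upwards [mem_nhdsWithin_of_mem_nhds hev, self_mem_nhdsWithin] with p hp hpt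
    set q := hΦC.localInverse hΦ' one_ne_zero p with hq
    have hp' : Φ q = p := hp
    have h1 : flowMap ν c A A' u₀ E₀ q.2 q.1 = p.1 := (Prod.ext_iff.1 hp').1
    have h2 : q.2 = p.2 := (Prod.ext_iff.1 hp').2
    rw [← h1, ← h2]
    exact hl q.1 q.2 (h2 ▸ hpt.2)
  exact (hL.fst.contDiffWithinAt).congr_of_eventuallyEq_of_mem heq ⟨mem_univ _, ht⟩

theorem hasDerivAt_flowMap_inverse (hA : IsImpulseResponse ν (k * c) A A') (hc : c ≠ 0)
    (hu : ContDiff ℝ 1 u₀) (hE : IsInitialField c ρ₀ E₀) (hρ : Continuous ρ₀)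
    (hpos : ∀ x t, 0 ≤ t → 0 < flowJacobian ν c A A' ρ₀ u₀ t x)
    (hr : ∀ y t, flowMap ν c A A' u₀ E₀ t (Ψ y t) = y)
    (hl : ∀ x t, 0 ≤ t → Ψ (flowMap ν c A A' u₀ E₀ t x) t = x) (y : ℝ) {t : ℝ} (ht : 0 ≤ t) :
    HasDerivAt (fun y => Ψ y t) (flowJacobian ν c A A' ρ₀ u₀ t (Ψ y t))⁻¹ y := by
  have hc' : Continuous fun y => Ψ y t :=
    (contDiffOn_flowMap_inverse hA hc hu hE hρ hpos hr hl).continuousOn.comp_continuous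
      (f := fun y => (y, t)) (by fun_prop) fun y => ⟨mem_univ _, ht⟩
  exact HasDerivAt.of_local_left_inverse (f := flowMap ν c A A' u₀ E₀ t) hc'.continuousAt
    (hasDerivAt_flowMap_space (hu.differentiable one_ne_zero) hE.hasDerivAt t _)
    (hpos _ t ht).ne' (Eventually.of_forall fun y => hr y t)

end inverse

/-- Positive Jacobian makes each flow map a `C¹` bijection of the line. Density, velocity and field
are their Lagrangian expressions pulled back by the inverse `Ψ`. The assumption `u₀ ∈ C²` makes the
Jacobian, hence the density, `C¹`. -/
theorem exists_isGlobalSolution (hA : IsImpulseResponse ν (k * c) A A') (hc : 0 < c)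
    (hd : IsInitialData c ρ₀ u₀) (hu₂ : ContDiff ℝ 2 u₀)
    (hpos : ∀ x t, 0 ≤ t → 0 < flowJacobian ν c A A' ρ₀ u₀ t x) :
    ∃ ρ u, IsGlobalSolution ν k c ρ₀ u₀ ρ u := by
  obtain ⟨E₀, hE⟩ := hd.exists_isInitialField
  have hu := hd.velocity_contDiff
  have hu' := hu.differentiable one_ne_zero
  have hρ := hd.density_contDiff
  have hEc := hE.contDiff hρ.continuous
  have hsurj := fun t => surjective_flowMap (ν := ν) (A := A) (A' := A') hu.continuous
    hd.velocity_atTop hd.velocity_atBot hE t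
  have hmono : ∀ t, 0 ≤ t → StrictMono (flowMap ν c A A' u₀ E₀ t) := fun t ht =>
    strictMono_of_deriv_pos fun x => by
      rw [(hasDerivAt_flowMap_space hu' hE.hasDerivAt t x).deriv]
      exact hpos x t ht
  set Ψ : ℝ → ℝ → ℝ := fun y t => Function.surjInv (hsurj t) y with hΨ
  have hr : ∀ y t, flowMap ν c A A' u₀ E₀ t (Ψ y t) = y := fun y t =>
    Function.surjInv_eq (hsurj t) y
  have hl : ∀ x t, 0 ≤ t → Ψ (flowMap ν c A A' u₀ E₀ t x) t = x := fun x t ht =>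
    (hmono t ht).injective (hr _ t)
  have hΨC := contDiffOn_flowMap_inverse hA hc.ne' hu hE hρ.continuous hpos hr hl
  have hΨ' : ∀ y t, 0 ≤ t → HasDerivAt (fun y => Ψ y t)
      (flowJacobian ν c A A' ρ₀ u₀ t (Ψ y t))⁻¹ y := fun y t ht =>
    hasDerivAt_flowMap_inverse hA hc.ne' hu hE hρ.continuous hpos hr hl y ht
  have hΨ0 : ∀ x, Ψ x 0 = x := fun x => by
    have := hl x 0 le_rfl
    rwa [hA.flowMap_zero] at this
  have hΨtop : ∀ t, 0 ≤ t → Tendsto (fun y => Ψ y t) atTop atTop := fun t ht =>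
    tendsto_atTop.2 fun b => by
      filter_upwards [eventually_ge_atTop (flowMap ν c A A' u₀ E₀ t b)] with y hy
      rw [← (hmono t ht).le_iff_le, hr]
      exact hy
  have hΨbot : ∀ t, 0 ≤ t → Tendsto (fun y => Ψ y t) atBot atBot := fun t ht =>
    tendsto_atBot.2 fun b => by
      filter_upwards [eventually_le_atBot (flowMap ν c A A' u₀ E₀ t b)] with y hy
      rw [← (hmono t ht).le_iff_le, hr]
      exact hy
  set ρ : ℝ → ℝ → ℝ := fun y t => ρ₀ (Ψ y t) / flowJacobian ν c A A' ρ₀ u₀ t (Ψ y t) with hρdef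
  set u : ℝ → ℝ → ℝ := fun y t => flowVelocity k A A' u₀ E₀ t (Ψ y t) with hudef
  -- The field in Lagrangian coordinates; the potential is a primitive in space of its pullback by
  -- `Ψ`.
  set W : ℝ → ℝ → ℝ := fun t x => E₀ x + c * (flowMap ν c A A' u₀ E₀ t x - x) with hW
  have hpairC : ContDiffOn ℝ 1 (fun p : ℝ × ℝ => (Ψ p.1 p.2, p.2)) (univ ×ˢ Ici 0) :=
    hΨC.prodMk contDiff_snd.contDiffOn
  have hρC : ContDiffOn ℝ 1 (fun p : ℝ × ℝ => ρ p.1 p.2) (univ ×ˢ Ici 0) :=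
    (hρ.comp_contDiffOn hΨC).div
      ((contDiff_flowJacobian hA (hu₂.iterate_deriv' 1 1) hρ).comp_contDiffOn hpairC)
      fun p hp => (hpos _ _ hp.2).ne'
  have huC : ContDiffOn ℝ 1 (fun p : ℝ × ℝ => u p.1 p.2) (univ ×ˢ Ici 0) :=
    (contDiff_flowVelocity hA hu hEc).comp_contDiffOn hpairC
  have hWx : ∀ t x, HasDerivAt (W t) (c * flowJacobian ν c A A' ρ₀ u₀ t x - ρ₀ x) x := fun t x =>
    ((hE.hasDerivAt x).add (((hasDerivAt_flowMap_space hu' hE.hasDerivAt t x).sub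
      (hasDerivAt_id x)).const_mul c)).congr_deriv (by ring)
  have hWΨ : ∀ y t, 0 ≤ t → HasDerivAt (fun y => W t (Ψ y t)) (c - ρ y t) y := fun y t ht => by
    refine (HasDerivAt.comp y (hWx t _) (hΨ' y t ht)).congr_deriv ?_
    have := (hpos (Ψ y t) t ht).ne'
    simp only [hρdef]
    field_simp
  have hWlim : ∀ {l : Filter ℝ}, Tendsto u₀ l (𝓝 0) → Tendsto E₀ l (𝓝 0) → ∀ t,
      Tendsto (W t) l (𝓝 0) := fun {l} h1 h2 t => by
    have h3 := h2.add (((h1.const_mul (A t)).add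
      (h2.const_mul ((A' t + ν * A t - 1) / c))).const_mul c)
    simp only [mul_zero, add_zero] at h3
    refine h3.congr fun x => ?_
    simp only [hW, flowMap]
    ring
  have hρcont : ∀ t, 0 ≤ t → Continuous fun y => ρ y t := fun t ht =>
    hρC.continuousOn.comp_continuous (f := fun y => (y, t)) (by fun_prop) fun y => ⟨mem_univ _, ht⟩
  have hux : ∀ y t, 0 ≤ t → HasDerivAt (fun y => u y t)
      ((A' t * deriv u₀ (Ψ y t) - k * A t * (c - ρ₀ (Ψ y t))) *
        (flowJacobian ν c A A' ρ₀ u₀ t (Ψ y t))⁻¹) y := fun y t ht =>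
    HasDerivAt.comp (h₂ := flowVelocity k A A' u₀ E₀ t) y
      (hasDerivAt_flowVelocity_space hu' hE.hasDerivAt t _) (hΨ' y t ht)
  refine ⟨ρ, u, hρC, huC, fun x => ?_, fun x => ?_, fun y t ht => ?_,
    fun y t => ∫ z in 0..y, W t (Ψ z t), fun t ht => ?_⟩
  · simp only [hρdef, hΨ0, hA.flowJacobian_zero, div_one]
  · simp only [hudef, hΨ0, flowVelocity, hA.zero, hA.one]; ring
  · obtain ⟨x, rfl⟩ := hsurj t y
    have hΓ := (hpos x t ht.le).ne'
    have h1 := hasDerivAt_comp_of_contDiffOn hρC ht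
      (hA.hasDerivAt_flowMap (u₀ := u₀) (E₀ := E₀) hc.ne' x t)
    have h2 : (fun s => ρ (flowMap ν c A A' u₀ E₀ s x) s) =ᶠ[𝓝 t]
        fun s => ρ₀ x / flowJacobian ν c A A' ρ₀ u₀ s x := by
      filter_upwards [Ioi_mem_nhds ht] with s hs
      simp only [hρdef, hl x s (mem_Ioi.1 hs).le]
    -- Along the particle path `ρ` equals `ρ₀ / Γ`. Comparing its time derivative with the chain
    -- rule gives `ρ_t + u ρ_x`, without a formula for `ρ_x`.
    have h3 := (h1.congr_of_eventuallyEq h2.symm).unique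
      ((hasDerivAt_const t (ρ₀ x)).div (hA.hasDerivAt_flowJacobian hc.ne' x t) hΓ)
    have h4 := hux (flowMap ν c A A' u₀ E₀ t x) t ht.le
    have hρy : DifferentiableAt ℝ (fun y => ρ y t) (flowMap ν c A A' u₀ E₀ t x) := by
      have hn : (univ ×ˢ Ici 0 : Set (ℝ × ℝ)) ∈ 𝓝 (flowMap ν c A A' u₀ E₀ t x, t) :=
        prod_mem_nhds univ_mem (Ici_mem_nhds ht)
      exact DifferentiableAt.comp (f := fun y => (y, t)) _
        ((hρC.contDiffAt hn).differentiableAt one_ne_zero) (by fun_prop)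
    have h5 : deriv (fun y => ρ y t * u y t) (flowMap ν c A A' u₀ E₀ t x) = _ :=
      (hρy.hasDerivAt.mul h4).deriv
    have hρv : ρ (flowMap ν c A A' u₀ E₀ t x) t = ρ₀ x / flowJacobian ν c A A' ρ₀ u₀ t x := by
      simp only [hρdef, hl x t ht.le]
    have huv : u (flowMap ν c A A' u₀ E₀ t x) t = flowVelocity k A A' u₀ E₀ t x := by
      simp only [hudef, hl x t ht.le]
    rw [h5, hρv, huv, hl x t ht.le]
    have h6 : deriv (fun s => ρ (flowMap ν c A A' u₀ E₀ t x) s) t =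
        (0 * flowJacobian ν c A A' ρ₀ u₀ t x - ρ₀ x * (A' t * deriv u₀ x - k * A t * (c - ρ₀ x))) /
          flowJacobian ν c A A' ρ₀ u₀ t x ^ 2 -
        deriv (fun y => ρ y t) (flowMap ν c A A' u₀ E₀ t x) * flowVelocity k A A' u₀ E₀ t x := by
      rw [← h3]; ring
    rw [h6]
    field_simp
    ring
  · have hWc : Continuous fun y => W t (Ψ y t) :=
      continuous_iff_continuousAt.2 fun y => (hWΨ y t ht.le).continuousAt
    have hφ' : ∀ y, HasDerivAt (fun y => ∫ z in 0..y, W t (Ψ z t)) (W t (Ψ y t)) y := fun y =>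
      (hWc.integral_hasStrictDerivAt 0 y).hasDerivAt
    have hφd : deriv (fun y => ∫ z in 0..y, W t (Ψ z t)) = fun y => W t (Ψ y t) :=
      funext fun y => (hφ' y).deriv
    rw [hφd]
    refine ⟨?_, (hWlim hd.velocity_atBot hE.tendsto_atBot t).comp (hΨbot t ht.le),
      (hWlim hd.velocity_atTop hE.tendsto_atTop t).comp (hΨtop t ht.le), fun y => ⟨?_, ?_⟩⟩
    · rw [show (2 : WithTop ℕ∞) = 1 + 1 by norm_num, contDiff_succ_iff_deriv, hφd]
      refine ⟨fun y => (hφ' y).differentiableAt, by simp, ?_⟩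
      rw [contDiff_one_iff_deriv, funext fun y => (hWΨ y t ht.le).deriv]
      exact ⟨fun y => (hWΨ y t ht.le).differentiableAt, continuous_const.sub (hρcont t ht.le)⟩
    · obtain ⟨x, rfl⟩ := hsurj t y
      have h1 := hasDerivAt_comp_of_contDiffOn huC ht
        (hA.hasDerivAt_flowMap (u₀ := u₀) (E₀ := E₀) hc.ne' x t)
      have h2 : (fun s => u (flowMap ν c A A' u₀ E₀ s x) s) =ᶠ[𝓝 t]
          fun s => flowVelocity k A A' u₀ E₀ s x := by
        filter_upwards [Ioi_mem_nhds ht] with s hs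
        simp only [hudef, hl x s (mem_Ioi.1 hs).le]
      have h3 := (h1.congr_of_eventuallyEq h2.symm).unique
        (hA.hasDerivAt_flowVelocity hc.ne' x t)
      have huv : u (flowMap ν c A A' u₀ E₀ t x) t = flowVelocity k A A' u₀ E₀ t x := by
        simp only [hudef, hl x t ht.le]
      beta_reduce
      rw [huv, hl x t ht.le]
      simp only [hW]
      linarith
    · rw [(hWΨ y t ht.le).deriv]
      ring

/-! ### The solvability criterion and its form in each damping regime -/

/-- Global solvability in terms of the flow. -/
theorem exists_isGlobalSolution_iff (hA : IsImpulseResponse ν (k * c) A A') (hν : 0 < ν)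
    (hk : 0 < k) (hc : 0 < c) (hd : IsInitialData c ρ₀ u₀) :
    (∃ ρ u, IsGlobalSolution ν k c ρ₀ u₀ ρ u) ↔ ContDiff ℝ 2 u₀ ∧
      ∀ x, ∀ t, 0 ≤ t → 0 < specificVolume ν c A A' (1 / ρ₀ x) (deriv u₀ x / ρ₀ x) t := by
  -- The Jacobian is linear in `(1, u₀', c - ρ₀)`; dividing by `ρ₀` leaves the oscillator with
  -- initial point `(1/ρ₀, u₀'/ρ₀)`.
  have hJ : ∀ x t, flowJacobian ν c A A' ρ₀ u₀ t x =
      ρ₀ x * specificVolume ν c A A' (1 / ρ₀ x) (deriv u₀ x / ρ₀ x) t := fun x t => by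
    have := (hd.density_pos x).ne'
    unfold flowJacobian specificVolume
    field_simp
    ring
  have hiff : ∀ x t, 0 < flowJacobian ν c A A' ρ₀ u₀ t x ↔
      0 < specificVolume ν c A A' (1 / ρ₀ x) (deriv u₀ x / ρ₀ x) t := fun x t => by
    rw [hJ]
    exact mul_pos_iff_of_pos_left (hd.density_pos x)
  constructor
  · rintro ⟨ρ, u, h⟩
    exact ⟨h.contDiff_two_velocity hν hk hc hA hd, fun x t ht =>
      (hiff x t).1 (h.flowJacobian_pos hν hk hc hA hd x ht)⟩
  · rintro ⟨hu, h⟩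
    exact exists_isGlobalSolution hA hc hd hu fun x t ht => (hiff x t).2 (h x t ht)

/-- The threshold curve in terms of an impulse response that never changes sign. -/
theorem exists_thresholdCurve_iff {A A' : ℝ → ℝ} (hA : IsImpulseResponse ν (k * c) A A')
    (hν : 0 < ν) (hk : 0 < k) (hc : 0 < c) (hpos : ∀ t, 0 < t → 0 < A t)
    (hback : ∀ t, 0 ≤ t → A (-t) ≤ -t) :
    ∃ Q : ℝ → ℝ, IsThresholdCurve ν k c Q ∧
      (∀ P, IsThresholdCurve ν k c P → EqOn P Q (Ici 0)) ∧
      ∀ ρ₀ u₀ : ℝ → ℝ, IsInitialData c ρ₀ u₀ →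
        ((∃ ρ u, IsGlobalSolution ν k c ρ₀ u₀ ρ u) ↔
          ContDiff ℝ 2 u₀ ∧ ∀ x, (ρ₀ x, deriv u₀ x) ∈ curveRegion Q) := by
  obtain ⟨Q, hQ, hQ'⟩ := hA.exists_thresholdCurve hν hk hc hpos hback
  refine ⟨Q, hQ, fun P hP => hP.eqOn hk hQ, fun ρ₀ u₀ hd => ?_⟩
  rw [exists_isGlobalSolution_iff hA hν hk hc hd]
  refine and_congr_right fun _ => forall_congr' fun x => ?_
  have hx := hd.density_pos x
  rw [hQ' _ _ (one_div_pos.2 hx), lt_div_iff₀ hx]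
  simp only [curveRegion, mem_ofPred_eq, hx, true_and]
  rw [show -Q (1 / ρ₀ x) * ρ₀ x = -ρ₀ x * Q (1 / ρ₀ x) by ring]

theorem exists_impulseResponse_of_overdamped (hν : 0 < ν) (hk : 0 < k) (hc : 0 < c)
    (h : 2 * √(k * c) < ν) :
    ∃ A A', IsImpulseResponse ν (k * c) A A' ∧ (∀ t, 0 < t → 0 < A t) ∧
      ∀ t, 0 ≤ t → A (-t) ≤ -t := by
  have hkc : 0 < k * c := mul_pos hk hc
  have h1 : 0 < ν ^ 2 / 4 - k * c := by
    have := Real.sq_sqrt hkc.le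
    have := Real.sqrt_nonneg (k * c)
    nlinarith
  set μ := √(ν ^ 2 / 4 - k * c) with hμ
  have hμ0 : 0 < μ := Real.sqrt_pos.2 h1
  refine ⟨_, _, isImpulseResponse_sinh hμ0.ne' (Real.sq_sqrt h1.le).symm, fun t ht => ?_,
    fun t ht => ?_⟩
  · have := Real.sinh_pos_iff.2 (mul_pos hμ0 ht)
    positivity
  · have h2 : t ≤ Real.sinh (μ * t) / μ := by
      rw [le_div_iff₀ hμ0, mul_comm]
      exact Real.self_le_sinh_iff.2 (by positivity)
    have h3 : 1 ≤ Real.exp (-(ν / 2) * -t) := Real.one_le_exp (by nlinarith)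
    simp only [mul_neg μ, Real.sinh_neg, neg_div, mul_neg]
    rw [mul_neg] at h3
    nlinarith

theorem exists_impulseResponse_of_critical (hν : 0 < ν) (hk : 0 < k) (hc : 0 < c)
    (h : ν = 2 * √(k * c)) :
    ∃ A A', IsImpulseResponse ν (k * c) A A' ∧ (∀ t, 0 < t → 0 < A t) ∧
      ∀ t, 0 ≤ t → A (-t) ≤ -t := by
  have h1 : ν ^ 2 / 4 = k * c := by
    rw [h, mul_pow, Real.sq_sqrt (mul_pos hk hc).le]; ring
  refine ⟨_, _, isImpulseResponse_critical h1, fun t ht => by positivity, fun t ht => ?_⟩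
  have h3 : 1 ≤ Real.exp (-(ν / 2) * -t) := Real.one_le_exp (by nlinarith)
  nlinarith

end EulerPoisson

theorem theorem2p3 (ν k c : ℝ) (hν : 0 < ν) (hk : 0 < k) (hc : 0 < c) :
    -- a global solution is unique
    (∀ ρ₀ u₀ : ℝ → ℝ, EulerPoisson.IsInitialData c ρ₀ u₀ → ∀ ρ u ρ' u' : ℝ → ℝ → ℝ,
      EulerPoisson.IsGlobalSolution ν k c ρ₀ u₀ ρ u →
      EulerPoisson.IsGlobalSolution ν k c ρ₀ u₀ ρ' u' →
      ∀ x t, 0 ≤ t → ρ x t = ρ' x t ∧ u x t = u' x t) ∧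
    -- strong damping
    (2 * √(k * c) < ν →
      ∃ Qa : ℝ → ℝ, EulerPoisson.IsThresholdCurve ν k c Qa ∧
        (∀ Q, EulerPoisson.IsThresholdCurve ν k c Q → Set.EqOn Q Qa (Set.Ici 0)) ∧
        ∀ ρ₀ u₀ : ℝ → ℝ, EulerPoisson.IsInitialData c ρ₀ u₀ →
          ((∃ ρ u, EulerPoisson.IsGlobalSolution ν k c ρ₀ u₀ ρ u) ↔
            ContDiff ℝ 2 u₀ ∧ ∀ x, (ρ₀ x, deriv u₀ x) ∈ EulerPoisson.curveRegion Qa)) ∧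
    -- borderline damping
    (ν = 2 * √(k * c) →
      ∃ Qb : ℝ → ℝ, EulerPoisson.IsThresholdCurve (2 * √(k * c)) k c Qb ∧
        (∀ Q, EulerPoisson.IsThresholdCurve (2 * √(k * c)) k c Q →
          Set.EqOn Q Qb (Set.Ici 0)) ∧
        ∀ ρ₀ u₀ : ℝ → ℝ, EulerPoisson.IsInitialData c ρ₀ u₀ →
          ((∃ ρ u, EulerPoisson.IsGlobalSolution ν k c ρ₀ u₀ ρ u) ↔
            ContDiff ℝ 2 u₀ ∧ ∀ x, (ρ₀ x, deriv u₀ x) ∈ EulerPoisson.curveRegion Qb)) ∧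
    -- weak damping
    (ν < 2 * √(k * c) →
      ∃ (S : ℝ) (Q₁ Q₂ : ℝ → ℝ), EulerPoisson.IsThresholdLoop ν k c S Q₁ Q₂ ∧
        (∀ S' Q₁' Q₂', EulerPoisson.IsThresholdLoop ν k c S' Q₁' Q₂' →
          S' = S ∧ Set.EqOn Q₁' Q₁ (Set.Icc 0 S) ∧ Set.EqOn Q₂' Q₂ (Set.Icc 0 S)) ∧
        ∀ ρ₀ u₀ : ℝ → ℝ, EulerPoisson.IsInitialData c ρ₀ u₀ →
          ((∃ ρ u, EulerPoisson.IsGlobalSolution ν k c ρ₀ u₀ ρ u) ↔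
            ContDiff ℝ 2 u₀ ∧
              ∀ x, (ρ₀ x, deriv u₀ x) ∈ EulerPoisson.loopRegion S Q₁ Q₂)) := by
  have hover : 2 * √(k * c) < ν → _ := fun h =>
    EulerPoisson.exists_impulseResponse_of_overdamped hν hk hc h
  have hcrit : ν = 2 * √(k * c) → _ := fun h =>
    EulerPoisson.exists_impulseResponse_of_critical hν hk hc h
  have hkc : 0 < k * c := mul_pos hk hc
  have hω : ν < 2 * √(k * c) → 0 < k * c - ν ^ 2 / 4 := fun h => by
    have := Real.sq_sqrt hkc.le
    nlinarith
  have hunder : ν < 2 * √(k * c) → _ := fun h =>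
    EulerPoisson.exists_thresholdLoop hν hk hc (Real.sqrt_pos.2 (hω h))
      (Real.sq_sqrt (hω h).le).symm
  refine ⟨fun ρ₀ u₀ hd ρ u ρ' u' hs hs' x t ht => ?_, fun h => ?_, fun h => ?_, fun h => ?_⟩
  · obtain ⟨A, A', hA⟩ : ∃ A A', EulerPoisson.IsImpulseResponse ν (k * c) A A' := by
      rcases lt_trichotomy ν (2 * √(k * c)) with h | h | h
      · obtain ⟨A, A', hA, -⟩ := hunder h
        exact ⟨A, A', hA⟩
      · obtain ⟨A, A', hA, -⟩ := hcrit h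
        exact ⟨A, A', hA⟩
      · obtain ⟨A, A', hA, -⟩ := hover h
        exact ⟨A, A', hA⟩
    exact hs.unique hs' hν hk hc hA hd x ht
  · obtain ⟨A, A', hA, hpos, hback⟩ := hover h
    exact EulerPoisson.exists_thresholdCurve_iff hA hν hk hc hpos hback
  · obtain ⟨A, A', hA, hpos, hback⟩ := hcrit h
    rw [← h]
    exact EulerPoisson.exists_thresholdCurve_iff hA hν hk hc hpos hback
  · obtain ⟨A, A', hA, S, Q₁, Q₂, hloop, hcS, hiff⟩ := hunder h
    refine ⟨S, Q₁, Q₂, hloop, fun S' Q₁' Q₂' hQ => hQ.unique hk hcS hloop, fun ρ₀ u₀ hd => ?_⟩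
    rw [EulerPoisson.exists_isGlobalSolution_iff hA hν hk hc hd]
    refine and_congr_right fun _ => forall_congr' fun x => ?_
    have hx := hd.density_pos x
    rw [hiff _ _ (one_div_pos.2 hx), one_div_lt hx hloop.pos, lt_div_iff₀ hx,
      div_lt_iff₀ hx]
    simp only [EulerPoisson.loopRegion, Set.mem_ofPred_eq]
    rw [show -Q₁ (1 / ρ₀ x) * ρ₀ x = -ρ₀ x * Q₁ (1 / ρ₀ x) by ring,
      show -Q₂ (S - 1 / ρ₀ x) * ρ₀ x = -ρ₀ x * Q₂ (S - 1 / ρ₀ x) by ring]
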